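/- **Theorem (generalized finite nonlinear B-Toda lattice).** Let $n$ be a nonnegative integer, $\alpha\ge 0$, $0<\zeta_1<\dots<\zeta_n$, $b_j(0)>0$, and put $$b_j(t)=b_j(0)e^{\zeta_j t},\qquad f_i(t)=\sum_{j=1}^n \zeta_j^{\,i}\,b_j(t)\qquad(i\ge 0).$$ For $t\in\mathbb R$ define Pfaffian entries, extended skew-symmetrically, by $$(d_0,i)=f_i(t),\qquad (i,j)=e^{-\alpha t}\iint_{-\infty<t_1<t_2<t}e^{\alpha t_2}\bigl[f_{i+1}(t_1)f_{j+1}(t_2)-f_{i+1}(t_2)f_{j+1}(t_1)\bigr]\,dt_1\,dt_2 ,$$ and the Pfaffians $$\tilde\tau_{2m}=(0,1,\dots,2m-1),\qquad \tilde\tau_{2m-1}=(d_0,0,1,\dots,2m-2),$$ with $\tilde\tau_0=1$ and $\tilde\tau_k=0$ for $k<0$. Here, for characters $c_1,\dots,c_{2N}$, $$(c_1,\dots,c_{2N})=\sum \operatorname{sgn}(i_1,\dots,i_{2N})\,(c_{i_1},c_{i_2})(c_{i_3},c_{i_4})\cdots(c_{i_{2N-1}},c_{i_{2N}}),$$ the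 sum being over all permutations $i_1,\dots,i_{2N}$ of $1,\dots,2N$ with $i_{2l-1}<i_{2l}$ and $i_{2l-1}<i_{2l+1}$. Then the double integrals converge absolutely, $\tilde\tau_k$ is differentiable and positive on $\mathbb R$ for $0\le k\le n$, $\tilde\tau_{n+1}=0$, and the functions $$\tilde p_k=\frac{\tilde\tau_{k+1}\tilde\tau_{k-1}}{\tilde\tau_k^{2}},\qquad \tilde q_k=\frac{d}{dt}\log\tilde\tau_k\qquad(0\le k\le n)$$ satisfy, for all $t\in\mathbb R$, the generalized finite nonlinear B-Toda lattice $$\dot{\tilde p}_k=\tilde p_k(\tilde q_{k+1}-2\tilde q_k+\tilde q_{k-1}),\qquad \dot{\tilde q}_k=(\tilde q_{k+1}-\tilde q_{k-1})\tilde p_k+\alpha\tilde p_k,\qquad k=1,\dots,n,$$ with the boundary conditions $\tilde p_0=\tilde p_n=\tilde q_0=\tilde p_n\tilde q_{n+1}=0$. (Since $\tilde\tau_{n+1}=0$, the function $\tilde q_{n+1}$ is not defined by the formula; it occurs only multiplied by $\tilde p_n=0$, and the claim holds for every choice of $\tilde q_{n+1}:\mathbb R\to\mathbb R$.) -/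

import Mathlib

open MeasureTheory

noncomputable section

namespace BToda

/-- The Pfaffian `Pf(1, …, 2N)` of a skew-symmetric array: the sum over all ways to write the
indices as a sequence of pairs `(i₁, i₂), …, (i_{2N-1}, i_{2N})` with `i_{2l-1} < i_{2l}` and
`i_{2l-1} < i_{2l+1}`, signed by the permutation `i₁, …, i_{2N}` (here counted from `0`).
Only the entries above the diagonal occur. For `N = 0` the value is `1`. -/
def pfaffian (N : ℕ) (A : Matrix (Fin (2 * N)) (Fin (2 * N)) ℝ) : ℝ :=
  open Classical in
  ∑ σ : Equiv.Perm (Fin (2 * N)) with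
      (∀ l : Fin N, σ ⟨2 * l, by omega⟩ < σ ⟨2 * l + 1, by omega⟩) ∧
        StrictMono (fun l : Fin N => σ ⟨2 * l, by omega⟩),
    ((Equiv.Perm.sign σ : ℤ) : ℝ) *
      ∏ l : Fin N, A (σ ⟨2 * l, by omega⟩) (σ ⟨2 * l + 1, by omega⟩)

/-- The moments `f_i(t) = ∑_j ζ_j^i b_j(t)` with `b_j(t) = b_j(0) e^{ζ_j t}`;
`b j` stands for the initial value `b_j(0)`. -/
def moment {n : ℕ} (ζ b : Fin n → ℝ) (i : ℕ) (t : ℝ) : ℝ :=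
  ∑ j, ζ j ^ i * (b j * Real.exp (ζ j * t))

/-- The domain `-∞ < t₁ < t₂ < t` of the double integrals. -/
def wedge (t : ℝ) : Set (ℝ × ℝ) := {x | x.1 < x.2 ∧ x.2 < t}

/-- The integrand `e^{α t₂} [f_{i+1}(t₁) f_{j+1}(t₂) - f_{i+1}(t₂) f_{j+1}(t₁)]`. -/
def entryIntegrand {n : ℕ} (α : ℝ) (ζ b : Fin n → ℝ) (i j : ℕ) (x : ℝ × ℝ) : ℝ :=
  Real.exp (α * x.2) *
    (moment ζ b (i + 1) x.1 * moment ζ b (j + 1) x.2 -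
      moment ζ b (i + 1) x.2 * moment ζ b (j + 1) x.1)

/-- The characters labelling the rows of the Pfaffians: `d₀` and the numbers `0, 1, 2, …`. -/
inductive Label : Type
  | d0 : Label
  | num : ℕ → Label

/-- The Pfaffian entries `(d₀, i) = f_i(t)` and
`(i, j) = e^{-αt} ∬_{-∞<t₁<t₂<t} e^{α t₂} [f_{i+1}(t₁) f_{j+1}(t₂) - f_{i+1}(t₂) f_{j+1}(t₁)]`,
extended skew-symmetrically. -/
def entry {n : ℕ} (α : ℝ) (ζ b : Fin n → ℝ) (t : ℝ) : Label → Label → ℝ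
  | .d0, .d0 => 0
  | .d0, .num i => moment ζ b i t
  | .num i, .d0 => -moment ζ b i t
  | .num i, .num j =>
      Real.exp (-(α * t)) * ∫ x in wedge t, entryIntegrand α ζ b i j x

/-- The sequence of characters `0, 1, 2, …`. -/
def evenLabels (i : ℕ) : Label := .num i

/-- The sequence of characters `d₀, 0, 1, 2, …`. -/
def oddLabels : ℕ → Label
  | 0 => .d0
  | i + 1 => .num i

/-- The tau functions: `τ_{2m} = (0, …, 2m-1)` and `τ_{2m-1} = (d₀, 0, …, 2m-2)`,
with `τ_0 = 1` and `τ_k = 0` for `k < 0`. -/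
def tau {n : ℕ} (α : ℝ) (ζ b : Fin n → ℝ) (k : ℤ) (t : ℝ) : ℝ :=
  if k < 0 then 0
  else if Even k then
    pfaffian (k.toNat / 2) fun i j => entry α ζ b t (evenLabels i) (evenLabels j)
  else
    pfaffian ((k.toNat + 1) / 2) fun i j => entry α ζ b t (oddLabels i) (oddLabels j)

/-- `(p, q)` solves the generalized finite nonlinear B-Toda lattice of size `n` with parameter
`α` for all times: the equations for `k = 1, …, n` and the boundary conditions
`p_0 = p_n = q_0 = p_n q_{n+1} = 0`. -/
structure IsLatticeSolution (n : ℕ) (α : ℝ) (p q : ℤ → ℝ → ℝ) : Prop where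
  p_zero : ∀ t, p 0 t = 0
  p_last : ∀ t, p n t = 0
  q_zero : ∀ t, q 0 t = 0
  p_mul_q_last : ∀ t, p n t * q (n + 1) t = 0
  hasDerivAt_p : ∀ k : ℤ, 1 ≤ k → k ≤ n → ∀ t,
    HasDerivAt (p k) (p k t * (q (k + 1) t - 2 * q k t + q (k - 1) t)) t
  hasDerivAt_q : ∀ k : ℤ, 1 ≤ k → k ≤ n → ∀ t,
    HasDerivAt (q k) ((q (k + 1) t - q (k - 1) t) * p k t + α * p k t) t

end BToda

end

/-!
The double integrals can be evaluated: with `b_k = b_k(t)` they give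
`(i, j) = ∑_{k,l} ζ_k^i ζ_l^j b_k b_l (ζ_l - ζ_k) / (α + ζ_k + ζ_l)` (`entry_num_num`), while
`(d₀, i) = ∑_k ζ_k^i b_k`. The tau functions are therefore Pfaffians of Gram arrays for a fixed
alternating form, and the proof rests on three groups of facts.

*Pfaffians.* For a skew-symmetric array the sum over canonical permutations equals, up to the factor
`2 ^ N * N!`, the sum over all permutations (`sum_pfTerm`), so the Pfaffian of a Gram array is an
alternating map of the vectors (`pfAlt_apply`). Gaussian elimination of a pair of labels
(`pfSeq_succ_eq_schurCompl`) then yields Schur's formula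
`Pf ((x_j - x_i) / (x_i + x_j)) = ∏_{i<j} (x_j - x_i) / (x_i + x_j)` (`pfSeq_schurEntry`) and, by
eliminating all common labels, the quadratic relations between Pfaffians
(`pfSeq_mul_pfSeq_four`, `pfSeq_two_mul_pfSeq_four`).

*Positivity.* Expanding the alternating map in the basis and symmetrizing turns the powers `ζ_k^i`
into a Vandermonde determinant. With Schur's formula at the nodes `ζ_k + α / 2`, to which `d₀` adds
the node `0`, this gives
`k! τ_k = ∑_φ ∏_i b_{φ i} ∏_{i<j} (ζ_{φ j} - ζ_{φ i})² / (α + ζ_{φ i} + ζ_{φ j})`, the sum being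
over all `φ : Fin k → Fin n` (`factorial_mul_tau`). The terms with injective `φ` are positive and the
others vanish; hence `τ_k > 0` for `k ≤ n` and `τ_{n+1} = 0`.

*Evolution.* The derivative of `(i, j)` is `(i + 1, j) + (i, j + 1)` and also
`(d₀, i) (d₁, j) - (d₀, j) (d₁, i) - α (i, j)`, where `(d₁, i) = f_{i+1}`. Accordingly the
derivative of a Pfaffian can be taken by raising its last number (`hasDerivAt_extPf_raise`), and
by adjoining `d₀, d₁` (`hasDerivAt_extPf_adjoin`) or replacing `d₀` by `d₁`
(`hasDerivAt_extPf_replace`). The quadratic relations thereby become the bilinear equation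
`τ_k'' τ_k - τ_k'² = τ_{k+1}' τ_{k-1} - τ_{k+1} τ_{k-1}' + α τ_{k+1} τ_{k-1}` (`bilinearAt`), which
is the lattice equation for `q_k`; the one for `p_k` follows by differentiating the
logarithm of `p_k = τ_{k+1} τ_{k-1} / τ_k²`.
-/

noncomputable section

namespace BToda

/-! ### The Pfaffian as an alternating map -/

/-- A permutation is canonical if it lists the indices as pairs, each pair increasing, with
increasing first members; the Pfaffian is a sum over these. -/
def IsCanonical {N : ℕ} (σ : Equiv.Perm (Fin (2 * N))) : Prop :=
  (∀ l : Fin N, σ ⟨2 * l, by omega⟩ < σ ⟨2 * l + 1, by omega⟩) ∧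
    StrictMono (fun l : Fin N => σ ⟨2 * l, by omega⟩)

/-- The summand of the Pfaffian belonging to a permutation. -/
def pfTerm {N : ℕ} (A : Fin (2 * N) → Fin (2 * N) → ℝ)
    (σ : Equiv.Perm (Fin (2 * N))) : ℝ :=
  ((Equiv.Perm.sign σ : ℤ) : ℝ) * ∏ l : Fin N, A (σ ⟨2 * l, by omega⟩) (σ ⟨2 * l + 1, by omega⟩)

open Classical in
theorem pfaffian_eq_sum_canonical (N : ℕ) (A : Fin (2 * N) → Fin (2 * N) → ℝ) :
    pfaffian N A = ∑ σ : Equiv.Perm (Fin (2 * N)) with IsCanonical σ, pfTerm A σ :=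
  Finset.sum_congr (Finset.filter_congr fun _ _ => Iff.rfl) fun _ _ => rfl

/-- The position `2 l + s` of the `s`-th member of the `l`-th pair. -/
def pairEquiv (N : ℕ) : Fin N × Fin 2 ≃ Fin (2 * N) where
  toFun x := ⟨2 * x.1 + x.2, by omega⟩
  invFun i := (⟨i / 2, by omega⟩, ⟨i % 2, by omega⟩)
  left_inv x := by
    ext <;> simp <;> omega
  right_inv i := by
    ext; simp; omega

/-- The permutation of the positions that permutes the pairs by `g.1` and the two members of each
pair by `g.2`. These are the permutations preserving the pairing. -/
def pairPerm {N : ℕ} (g : Equiv.Perm (Fin N) × (Fin N → Equiv.Perm (Fin 2))) :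
    Equiv.Perm (Fin (2 * N)) :=
  (pairEquiv N).permCongr
    ((Equiv.prodCongrLeft fun _ : Fin 2 => g.1).trans (Equiv.prodCongrRight g.2))

theorem pairPerm_apply {N : ℕ} (g : Equiv.Perm (Fin N) × (Fin N → Equiv.Perm (Fin 2)))
    (l : Fin N) (s : Fin 2) :
    pairPerm g (pairEquiv N (l, s)) = pairEquiv N (g.1 l, g.2 (g.1 l) s) := by
  simp [pairPerm, Equiv.permCongr_apply]

theorem sign_pairPerm {N : ℕ} (g : Equiv.Perm (Fin N) × (Fin N → Equiv.Perm (Fin 2))) :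
    Equiv.Perm.sign (pairPerm g) = ∏ l, Equiv.Perm.sign (g.2 l) := by
  rw [pairPerm, Equiv.Perm.sign_permCongr]
  have := Equiv.Perm.sign_trans (Equiv.prodCongrLeft fun _ : Fin 2 => g.1)
    (Equiv.prodCongrRight g.2)
  rw [this, Equiv.Perm.sign_prodCongrRight, Equiv.Perm.sign_prodCongrLeft]
  simp

theorem pfTerm_eq {N : ℕ} (A : Fin (2 * N) → Fin (2 * N) → ℝ)
    (σ : Equiv.Perm (Fin (2 * N))) :
    pfTerm A σ = ((Equiv.Perm.sign σ : ℤ) : ℝ) *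
      ∏ l : Fin N, A (σ (pairEquiv N (l, 0))) (σ (pairEquiv N (l, 1))) := rfl

theorem perm_fin_two_cases (ε : Equiv.Perm (Fin 2)) : ε = 1 ∨ ε = Equiv.swap 0 1 := by
  revert ε; decide

/-- Flipping a pair changes both the sign and the factor of that pair; permuting the pairs is an
even permutation of the positions. -/
theorem pfTerm_mul_pairPerm {N : ℕ} {A : Fin (2 * N) → Fin (2 * N) → ℝ}
    (hA : ∀ i j, A j i = -A i j) (σ : Equiv.Perm (Fin (2 * N)))
    (g : Equiv.Perm (Fin N) × (Fin N → Equiv.Perm (Fin 2))) :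
    pfTerm A (σ * pairPerm g) = pfTerm A σ := by
  have key : ∀ l, A (σ (pairEquiv N (l, g.2 l 0))) (σ (pairEquiv N (l, g.2 l 1))) =
      ((Equiv.Perm.sign (g.2 l) : ℤ) : ℝ) *
        A (σ (pairEquiv N (l, 0))) (σ (pairEquiv N (l, 1))) := by
    intro l
    rcases perm_fin_two_cases (g.2 l) with h | h
    · simp [h]
    · rw [h, Equiv.Perm.sign_swap (by decide)]
      simp [hA (σ (pairEquiv N (l, 0)))]
  rw [pfTerm_eq, pfTerm_eq]
  simp only [Equiv.Perm.mul_apply, pairPerm_apply]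
  rw [Equiv.prod_comp g.1 fun l =>
    A (σ (pairEquiv N (l, g.2 l 0))) (σ (pairEquiv N (l, g.2 l 1)))]
  rw [Finset.prod_congr rfl fun l _ => key l, Finset.prod_mul_distrib, Equiv.Perm.sign_mul,
    sign_pairPerm]
  push_cast
  have hsq : (∏ l, ((Equiv.Perm.sign (g.2 l) : ℤ) : ℝ)) *
      (∏ l, ((Equiv.Perm.sign (g.2 l) : ℤ) : ℝ)) = 1 := by
    rw [← Finset.prod_mul_distrib]
    refine Finset.prod_eq_one fun l _ => ?_
    rcases Int.units_eq_one_or (Equiv.Perm.sign (g.2 l)) with h | h <;> simp [h]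
  linear_combination (((Equiv.Perm.sign σ : ℤ) : ℝ) *
      ∏ l : Fin N, A (σ (pairEquiv N (l, 0))) (σ (pairEquiv N (l, 1)))) * hsq

/-- Every permutation becomes canonical after exactly one rearrangement of its pairs. -/
theorem existsUnique_isCanonical_mul_pairPerm {N : ℕ} (σ : Equiv.Perm (Fin (2 * N))) :
    ∃! g : Equiv.Perm (Fin N) × (Fin N → Equiv.Perm (Fin 2)), IsCanonical (σ * pairPerm g) := by
  have hcan : ∀ g : Equiv.Perm (Fin N) × (Fin N → Equiv.Perm (Fin 2)),
      IsCanonical (σ * pairPerm g) ↔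
        (∀ l, σ (pairEquiv N (l, g.2 l 0)) < σ (pairEquiv N (l, g.2 l 1))) ∧
          StrictMono fun l => σ (pairEquiv N (g.1 l, g.2 (g.1 l) 0)) := by
    intro g
    have h0 : ∀ l, (σ * pairPerm g) (pairEquiv N (l, 0)) =
        σ (pairEquiv N (g.1 l, g.2 (g.1 l) 0)) := fun l => by
      rw [Equiv.Perm.mul_apply, pairPerm_apply]
    have h1 : ∀ l, (σ * pairPerm g) (pairEquiv N (l, 1)) =
        σ (pairEquiv N (g.1 l, g.2 (g.1 l) 1)) := fun l => by
      rw [Equiv.Perm.mul_apply, pairPerm_apply]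
    have : IsCanonical (σ * pairPerm g) ↔
        (∀ l, (σ * pairPerm g) (pairEquiv N (l, 0)) < (σ * pairPerm g) (pairEquiv N (l, 1))) ∧
          StrictMono fun l => (σ * pairPerm g) (pairEquiv N (l, 0)) := Iff.rfl
    rw [this]
    simp only [h0, h1]
    exact and_congr_left fun _ => g.1.forall_congr_right
      (q := fun l => σ (pairEquiv N (l, g.2 l 0)) < σ (pairEquiv N (l, g.2 l 1)))
  have hflip : ∀ l, ∃! ε : Equiv.Perm (Fin 2),
      σ (pairEquiv N (l, ε 0)) < σ (pairEquiv N (l, ε 1)) := by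
    intro l
    have hne : σ (pairEquiv N (l, 0)) ≠ σ (pairEquiv N (l, 1)) := by
      intro h
      have := (pairEquiv N).injective (σ.injective h)
      simp at this
    rcases lt_or_gt_of_ne hne with h | h
    · refine ⟨1, by simpa using h, fun ε hε => ?_⟩
      rcases perm_fin_two_cases ε with rfl | rfl
      · rfl
      · exact absurd h (not_lt_of_gt (by simpa using hε))
    · refine ⟨Equiv.swap 0 1, by simpa using h, fun ε hε => ?_⟩
      rcases perm_fin_two_cases ε with rfl | rfl
      · exact absurd h (not_lt_of_gt (by simpa using hε))
      · rfl
  choose ε hε hεu using hflip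
  set m : Fin N → Fin (2 * N) := fun l => σ (pairEquiv N (l, ε l 0)) with hm
  have hminj : Function.Injective m := by
    intro a c h
    have := (pairEquiv N).injective (σ.injective h)
    exact (Prod.ext_iff.1 this).1
  refine ⟨(Tuple.sort m, ε), (hcan _).2 ⟨hε, ?_⟩, ?_⟩
  · exact (Tuple.monotone_sort m).strictMono_of_injective
      (hminj.comp (Tuple.sort m).injective)
  · rintro ⟨π, ε'⟩ h
    obtain ⟨h1, h2⟩ := (hcan _).1 h
    obtain rfl : ε' = ε := funext fun l => hεu l _ (h1 l)
    have h3 : m ∘ π = m ∘ Tuple.sort m :=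
      Tuple.unique_monotone h2.monotone (Tuple.monotone_sort m)
    have h4 : π = Tuple.sort m := Equiv.ext fun l => hminj (congrFun h3 l)
    rw [h4]

/-- The number `2 ^ N * N!` of permutations that preserve the pairing. -/
def pairCard (N : ℕ) : ℝ :=
  Fintype.card (Equiv.Perm (Fin N) × (Fin N → Equiv.Perm (Fin 2)))

theorem pairCard_ne_zero (N : ℕ) : pairCard N ≠ 0 :=
  Nat.cast_ne_zero.2 Fintype.card_ne_zero

/-- For a skew-symmetric array the sum over all permutations counts every canonical term
`2 ^ N * N!` times. -/
theorem sum_pfTerm {N : ℕ} {A : Fin (2 * N) → Fin (2 * N) → ℝ}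
    (hA : ∀ i j, A j i = -A i j) : ∑ σ, pfTerm A σ = pairCard N * pfaffian N A := by
  classical
  rw [pfaffian_eq_sum_canonical]
  have h1 : ∀ σ : Equiv.Perm (Fin (2 * N)), pfTerm A σ =
      ∑ g : Equiv.Perm (Fin N) × (Fin N → Equiv.Perm (Fin 2)),
        if IsCanonical (σ * pairPerm g) then pfTerm A (σ * pairPerm g) else 0 := by
    intro σ
    obtain ⟨g, hg, hgu⟩ := existsUnique_isCanonical_mul_pairPerm σ
    rw [Finset.sum_eq_single g]
    · rw [if_pos hg, pfTerm_mul_pairPerm hA]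
    · intro g' _ hne
      exact if_neg fun h => hne (hgu g' h)
    · simp
  rw [Finset.sum_congr rfl fun σ _ => h1 σ, Finset.sum_comm]
  have h2 : ∀ g : Equiv.Perm (Fin N) × (Fin N → Equiv.Perm (Fin 2)),
      (∑ σ, if IsCanonical (σ * pairPerm g) then pfTerm A (σ * pairPerm g) else 0) =
        ∑ σ : Equiv.Perm (Fin (2 * N)) with IsCanonical σ, pfTerm A σ := by
    intro g
    rw [Finset.sum_filter]
    exact Equiv.sum_comp (Equiv.mulRight (pairPerm g))
      fun σ => if IsCanonical σ then pfTerm A σ else 0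
  rw [Finset.sum_congr rfl fun g _ => h2 g, Finset.sum_const, pairCard, nsmul_eq_mul,
    Finset.card_univ]

section

variable {E : Type*} [AddCommGroup E] [Module ℝ E]

/-- Every factor of `∏_l ω (v (2 l)) (v (2 l + 1))` but one is independent of a given `v i`. -/
theorem exists_linear_prod_update (ω : E →ₗ[ℝ] E →ₗ[ℝ] ℝ) {N : ℕ} [DecidableEq (Fin (2 * N))]
    (v : Fin (2 * N) → E) (i : Fin (2 * N)) :
    ∃ φ : E →ₗ[ℝ] ℝ, ∀ x, ∏ l : Fin N, ω (Function.update v i x (pairEquiv N (l, 0)))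
      (Function.update v i x (pairEquiv N (l, 1))) = φ x := by
  obtain ⟨⟨k, s⟩, rfl⟩ := (pairEquiv N).surjective i
  set r : ℝ := ∏ l ∈ Finset.univ.erase k,
    ω (v (pairEquiv N (l, 0))) (v (pairEquiv N (l, 1))) with hr
  have hrest : ∀ x, ∏ l ∈ Finset.univ.erase k,
      ω (Function.update v (pairEquiv N (k, s)) x (pairEquiv N (l, 0)))
      (Function.update v (pairEquiv N (k, s)) x (pairEquiv N (l, 1))) = r := by
    intro x
    refine Finset.prod_congr rfl fun l hl => ?_
    have hlk := Finset.ne_of_mem_erase hl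
    have hne : ∀ s', pairEquiv N (l, s') ≠ pairEquiv N (k, s) := fun s' h =>
      hlk (Prod.ext_iff.1 ((pairEquiv N).injective h)).1
    rw [Function.update_of_ne (hne 0), Function.update_of_ne (hne 1)]
  have h01 : ∀ s' s'' : Fin 2, s' ≠ s'' → pairEquiv N (k, s') ≠ pairEquiv N (k, s'') :=
    fun s' s'' hs h => hs (Prod.ext_iff.1 ((pairEquiv N).injective h)).2
  rcases (by decide : ∀ s : Fin 2, s = 0 ∨ s = 1) s with rfl | rfl
  · refine ⟨r • ω.flip (v (pairEquiv N (k, 1))), fun x => ?_⟩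
    rw [← Finset.mul_prod_erase _ _ (Finset.mem_univ k), hrest, Function.update_self,
      Function.update_of_ne (h01 1 0 (by decide))]
    simp [mul_comm]
  · refine ⟨r • ω (v (pairEquiv N (k, 0))), fun x => ?_⟩
    rw [← Finset.mul_prod_erase _ _ (Finset.mem_univ k), hrest, Function.update_self,
      Function.update_of_ne (h01 0 1 (by decide))]
    simp [mul_comm]

/-- The multilinear map `v ↦ ∏_l ω (v (2 l)) (v (2 l + 1))`. -/
def pairProd (ω : E →ₗ[ℝ] E →ₗ[ℝ] ℝ) (N : ℕ) :
    MultilinearMap ℝ (fun _ : Fin (2 * N) => E) ℝ where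
  toFun v := ∏ l : Fin N, ω (v (pairEquiv N (l, 0))) (v (pairEquiv N (l, 1)))
  map_update_add' v i x y := by
    obtain ⟨φ, hφ⟩ := exists_linear_prod_update ω v i
    simp only [hφ, map_add]
  map_update_smul' v i c x := by
    obtain ⟨φ, hφ⟩ := exists_linear_prod_update ω v i
    simp only [hφ, map_smul]

/-- The Pfaffian of the Gram array of `2 N` vectors with respect to an alternating form `ω`,
as an alternating map; see `pfAlt_apply`. -/
def pfAlt (ω : E →ₗ[ℝ] E →ₗ[ℝ] ℝ) (N : ℕ) : E [⋀^Fin (2 * N)]→ₗ[ℝ] ℝ :=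
  (pairCard N)⁻¹ • MultilinearMap.alternatization (pairProd ω N)

/-- The value of `pfAlt` is the Pfaffian of the Gram array, by `sum_pfTerm`. -/
theorem pfAlt_apply {ω : E →ₗ[ℝ] E →ₗ[ℝ] ℝ} (hω : ω.IsAlt) (N : ℕ) (v : Fin (2 * N) → E) :
    pfAlt ω N v = pfaffian N fun i j => ω (v i) (v j) := by
  have h : ∑ σ, pfTerm (fun i j => ω (v i) (v j)) σ =
      pairCard N * pfaffian N fun i j => ω (v i) (v j) :=
    sum_pfTerm (A := fun i j => ω (v i) (v j)) fun i j => (hω.neg (v i) (v j)).symm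
  rw [pfAlt, AlternatingMap.smul_apply, MultilinearMap.alternatization_apply, smul_eq_mul,
    inv_mul_eq_iff_eq_mul₀ (pairCard_ne_zero N), ← h]
  refine Finset.sum_congr rfl fun σ _ => ?_
  rw [pfTerm_eq, Units.smul_def, zsmul_eq_mul]
  rfl

end

/-- The bilinear form on the space freely spanned by labels that extends an array indexed by
labels. -/
def labelForm {L : Type*} (A : L → L → ℝ) : (L →₀ ℝ) →ₗ[ℝ] (L →₀ ℝ) →ₗ[ℝ] ℝ :=
  Finsupp.linearCombination ℝ fun a => Finsupp.linearCombination ℝ (A a)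

@[simp] theorem labelForm_single {L : Type*} (A : L → L → ℝ) (a c : L) :
    labelForm A (Finsupp.single a 1) (Finsupp.single c 1) = A a c := by
  simp [labelForm]

theorem labelForm_isAlt {L : Type*} {A : L → L → ℝ} (hA : ∀ a c, A c a = -A a c) :
    (labelForm A).IsAlt := by
  have h : labelForm A = -(labelForm A).flip := by
    ext a c
    simpa using hA c a
  intro x
  have := LinearMap.congr_fun (LinearMap.congr_fun h x) x
  simp only [LinearMap.neg_apply, LinearMap.flip_apply] at this
  linarith

/-! ### Sequences of labels -/

/-- The Pfaffian of the upper left `2 N × 2 N` block of an array indexed by `ℕ`. -/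
def pfSeq (N : ℕ) (C : ℕ → ℕ → ℝ) : ℝ := pfaffian N fun i j => C i j

theorem pfSeq_congr {N : ℕ} {C D : ℕ → ℕ → ℝ}
    (h : ∀ i < 2 * N, ∀ j < 2 * N, C i j = D i j) : pfSeq N C = pfSeq N D := by
  unfold pfSeq
  congr 1
  ext i j
  exact h i i.2 j j.2

/-- Labels are basis vectors of the space they span freely, so that Pfaffians of labels inherit the
properties of alternating maps. -/
theorem pfSeq_labels {L : Type*} {A : L → L → ℝ} (hA : ∀ a c, A c a = -A a c) (N : ℕ)
    (u : ℕ → L) : pfSeq N (fun i j => A (u i) (u j)) =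
      pfAlt (labelForm A) N fun i => Finsupp.single (u i) 1 := by
  rw [pfAlt_apply (labelForm_isAlt hA)]
  simp [pfSeq]

/-- A Pfaffian with a repeated label vanishes. -/
theorem pfSeq_eq_zero_of_eq {L : Type*} {A : L → L → ℝ} (hA : ∀ a c, A c a = -A a c) {N : ℕ}
    (u : ℕ → L) {i j : ℕ} (hi : i < 2 * N) (hj : j < 2 * N) (hij : i ≠ j) (h : u i = u j) :
    pfSeq N (fun i j => A (u i) (u j)) = 0 := by
  rw [pfSeq_labels hA]
  exact AlternatingMap.map_eq_zero_of_eq _ _ (i := ⟨i, hi⟩) (j := ⟨j, hj⟩) (by simp [h])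
    (by simpa using hij)

/-- Moving the first label to the end changes the sign. -/
theorem pfSeq_rotate {L : Type*} {A : L → L → ℝ} (hA : ∀ a c, A c a = -A a c) (N : ℕ)
    (u w : ℕ → L) (h0 : w (2 * N + 1) = u 0) (hw : ∀ i ≤ 2 * N, w i = u (i + 1)) :
    pfSeq (N + 1) (fun i j => A (w i) (w j)) = -pfSeq (N + 1) fun i j => A (u i) (u j) := by
  rw [pfSeq_labels hA, pfSeq_labels hA]
  have h := AlternatingMap.map_perm (pfAlt (labelForm A) (N + 1))
    (fun i => Finsupp.single (u i) 1) (finRotate (2 * (N + 1)))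
  have hs : Equiv.Perm.sign (finRotate (2 * (N + 1))) = -1 := by
    rw [sign_finRotate]
    exact Odd.neg_one_pow ⟨N, by omega⟩
  rw [hs] at h
  rw [show (fun i : Fin (2 * (N + 1)) => Finsupp.single (w i) (1 : ℝ)) =
    (fun i : Fin (2 * (N + 1)) => Finsupp.single (u i) (1 : ℝ)) ∘ finRotate (2 * (N + 1)) from ?_,
    h]
  · simp
  · ext1 i
    rcases Nat.lt_or_ge i (2 * N + 1) with hi | hi
    · have : ((finRotate (2 * N + 1 + 1) ⟨i, by omega⟩ : Fin (2 * N + 1 + 1)) : ℕ) = i + 1 :=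
        congrArg Fin.val (finRotate_of_lt hi)
      simp only [Function.comp]
      rw [hw i (by omega)]
      congr 2
      exact this.symm
    · have h1 : i = (Fin.last (2 * N + 1)) := Fin.ext (by simp; omega)
      subst h1
      have : ((finRotate (2 * N + 1 + 1) (Fin.last (2 * N + 1)) : Fin (2 * N + 1 + 1)) : ℕ) = 0 :=
        congrArg Fin.val finRotate_last
      simp only [Function.comp]
      rw [Fin.val_last, h0]
      congr 2
      exact this.symm

/-! ### Splitting off the first pair -/

/-- In a canonical arrangement the index `0` is the first member of the first pair. -/
theorem IsCanonical.apply_zero {N : ℕ} {σ : Equiv.Perm (Fin (2 * (N + 1)))}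
    (hσ : IsCanonical σ) : σ ⟨0, by omega⟩ = ⟨0, by omega⟩ := by
  obtain ⟨i, hi⟩ := σ.surjective ⟨0, by omega⟩
  obtain ⟨⟨l, s⟩, rfl⟩ := (pairEquiv (N + 1)).surjective i
  rcases (by decide : ∀ s : Fin 2, s = 0 ∨ s = 1) s with rfl | rfl
  · rcases Nat.eq_zero_or_pos l with h | h
    · obtain rfl : l = 0 := Fin.ext h
      exact hi
    · have h1 := hσ.2 (show (0 : Fin (N + 1)) < l from h)
      have h2 : σ (pairEquiv (N + 1) (l, 0)) = σ ⟨2 * l, by omega⟩ := rfl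
      simp only [← h2, hi] at h1
      exact absurd (Fin.lt_def.1 h1) (by simp)
  · have h1 := hσ.1 l
    have h2 : σ (pairEquiv (N + 1) (l, 1)) = σ ⟨2 * l + 1, by omega⟩ := rfl
    rw [← h2, hi] at h1
    exact absurd (Fin.lt_def.1 h1) (by simp)

/-- The extension of a permutation by two fixed points in front. -/
def extendPair {N : ℕ} (e : Equiv.Perm (Fin (2 * N))) : Equiv.Perm (Fin (2 * (N + 1))) :=
  (Equiv.Perm.decomposeFin.symm (0, Equiv.Perm.decomposeFin.symm (0, e)) :
    Equiv.Perm (Fin (2 * N + 1 + 1)))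

theorem extendPair_zero {N : ℕ} (e : Equiv.Perm (Fin (2 * N))) :
    extendPair e ⟨0, by omega⟩ = ⟨0, by omega⟩ :=
  Equiv.Perm.decomposeFin_symm_apply_zero (n := 2 * N + 1) _ _

theorem extendPair_one {N : ℕ} (e : Equiv.Perm (Fin (2 * N))) :
    extendPair e ⟨1, by omega⟩ = ⟨1, by omega⟩ := by
  have := Equiv.Perm.decomposeFin_symm_apply_succ (n := 2 * N + 1)
    (Equiv.Perm.decomposeFin.symm (0, e)) 0 0
  rw [Equiv.Perm.decomposeFin_symm_apply_zero, Equiv.swap_self] at this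
  exact this

theorem extendPair_add_two {N : ℕ} (e : Equiv.Perm (Fin (2 * N))) (i : ℕ) (hi : i < 2 * N) :
    extendPair e ⟨i + 2, by omega⟩ = ⟨e ⟨i, hi⟩ + 2, by omega⟩ := by
  have h1 := Equiv.Perm.decomposeFin_symm_apply_succ (n := 2 * N + 1)
    (Equiv.Perm.decomposeFin.symm (0, e)) 0 (Fin.succ ⟨i, hi⟩)
  have h2 := Equiv.Perm.decomposeFin_symm_apply_succ (n := 2 * N) e 0 ⟨i, hi⟩
  rw [Equiv.swap_self] at h1 h2
  rw [h2] at h1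
  exact h1

theorem sign_extendPair {N : ℕ} (e : Equiv.Perm (Fin (2 * N))) :
    Equiv.Perm.sign (extendPair e) = Equiv.Perm.sign e := by
  have h1 := Equiv.Perm.decomposeFin.symm_sign (n := 2 * N + 1) 0
    (Equiv.Perm.decomposeFin.symm (0, e))
  have h2 := Equiv.Perm.decomposeFin.symm_sign (n := 2 * N) 0 e
  rw [if_pos rfl, one_mul] at h1 h2
  exact h1.trans h2

theorem exists_extendPair {N : ℕ} (σ : Equiv.Perm (Fin (2 * (N + 1))))
    (h0 : σ ⟨0, by omega⟩ = ⟨0, by omega⟩) (h1 : σ ⟨1, by omega⟩ = ⟨1, by omega⟩) :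
    ∃ e, extendPair e = σ := by
  obtain ⟨⟨p, σ'⟩, hσ⟩ := (Equiv.Perm.decomposeFin (n := 2 * N + 1)).symm.surjective σ
  obtain ⟨⟨p', e⟩, rfl⟩ := (Equiv.Perm.decomposeFin (n := 2 * N)).symm.surjective σ'
  obtain rfl : p = 0 := by
    rw [← Equiv.Perm.decomposeFin_symm_apply_zero (n := 2 * N + 1) p
      (Equiv.Perm.decomposeFin.symm (p', e)), hσ]
    exact h0
  obtain rfl : p' = 0 := by
    have := Equiv.Perm.decomposeFin_symm_apply_succ (n := 2 * N + 1)
      (Equiv.Perm.decomposeFin.symm (p', e)) 0 0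
    rw [Equiv.Perm.decomposeFin_symm_apply_zero, Equiv.swap_self, hσ] at this
    have h2 : p'.succ = (1 : Fin (2 * N + 1 + 1)) := this.symm.trans h1
    exact Fin.succ_injective _ h2
  exact ⟨e, hσ⟩

theorem isCanonical_extendPair {N : ℕ} (e : Equiv.Perm (Fin (2 * N))) :
    IsCanonical (extendPair e) ↔ IsCanonical e := by
  have h0 : ∀ l : Fin N, extendPair e ⟨2 * (l.succ : Fin (N + 1)), by omega⟩ =
      ⟨e ⟨2 * l, by omega⟩ + 2, by omega⟩ := fun l => extendPair_add_two e (2 * l) (by omega)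
  have h1 : ∀ l : Fin N, extendPair e ⟨2 * (l.succ : Fin (N + 1)) + 1, by omega⟩ =
      ⟨e ⟨2 * l + 1, by omega⟩ + 2, by omega⟩ := fun l =>
    extendPair_add_two e (2 * l + 1) (by omega)
  have hz : extendPair e ⟨2 * ((0 : Fin (N + 1)) : ℕ), by simp⟩ = ⟨0, by omega⟩ :=
    extendPair_zero e
  have ho : extendPair e ⟨2 * ((0 : Fin (N + 1)) : ℕ) + 1, by simp; omega⟩ = ⟨1, by omega⟩ :=
    extendPair_one e
  constructor
  · rintro ⟨ha, hb⟩
    refine ⟨fun l => ?_, fun l l' hl => ?_⟩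
    · have := ha l.succ
      rw [h0, h1] at this
      exact Fin.lt_def.2 (Nat.lt_of_add_lt_add_right (Fin.lt_def.1 this))
    · have := hb (Fin.succ_lt_succ_iff.2 hl)
      simp only [h0] at this
      exact Fin.lt_def.2 (Nat.lt_of_add_lt_add_right (Fin.lt_def.1 this))
  · rintro ⟨ha, hb⟩
    refine ⟨fun l => ?_, fun l l' hl => ?_⟩
    · induction l using Fin.cases with
      | zero => rw [hz, ho]; exact Nat.one_pos
      | succ l =>
        rw [h0, h1]
        exact Fin.lt_def.2 (Nat.add_lt_add_right (Fin.lt_def.1 (ha l)) 2)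
    · induction l' using Fin.cases with
      | zero => exact absurd hl (by simp)
      | succ l' =>
        induction l using Fin.cases with
        | zero => simp only [hz, h0]; exact Nat.succ_pos _
        | succ l =>
          simp only [h0]
          exact Fin.lt_def.2
            (Nat.add_lt_add_right (Fin.lt_def.1 (hb (Fin.succ_lt_succ_iff.1 hl))) 2)

open Classical in
/-- The terms of the Pfaffian in which the first two indices are not paired with each other. -/
def pfRest (N : ℕ) (C : ℕ → ℕ → ℝ) : ℝ :=
  ∑ σ : Equiv.Perm (Fin (2 * (N + 1))) with
    IsCanonical σ ∧ σ ⟨1, by omega⟩ ≠ ⟨1, by omega⟩, pfTerm (fun i j => C i j) σ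

/-- Sorting the canonical permutations by whether the first two indices form a pair. -/
theorem pfSeq_succ (N : ℕ) (C : ℕ → ℕ → ℝ) :
    pfSeq (N + 1) C = C 0 1 * pfSeq N (fun i j => C (i + 2) (j + 2)) + pfRest N C := by
  classical
  rw [pfSeq, pfaffian_eq_sum_canonical, pfSeq, pfaffian_eq_sum_canonical, pfRest,
    ← Finset.sum_filter_add_sum_filter_not _ fun σ : Equiv.Perm (Fin (2 * (N + 1))) =>
      σ ⟨1, by omega⟩ = ⟨1, by omega⟩, Finset.filter_filter, Finset.filter_filter]
  congr 1
  rw [Finset.mul_sum]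
  symm
  refine Finset.sum_nbij extendPair ?_ ?_ ?_ ?_
  · intro e he
    simp only [Finset.mem_filter, Finset.mem_univ, true_and] at he ⊢
    exact ⟨(isCanonical_extendPair e).2 he, extendPair_one e⟩
  · intro e _ e' _ h
    ext i
    have := congrArg (fun σ : Equiv.Perm (Fin (2 * (N + 1))) => (σ ⟨i + 2, by omega⟩ : ℕ)) h
    simpa [extendPair_add_two _ i.1 i.2] using this
  · intro σ hσ
    simp only [Finset.coe_filter, Finset.mem_univ, true_and, Set.mem_ofPred_eq] at hσ
    obtain ⟨e, rfl⟩ := exists_extendPair σ hσ.1.apply_zero hσ.2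
    exact ⟨e, by simpa using (isCanonical_extendPair e).1 hσ.1, rfl⟩
  · intro e _
    unfold pfTerm
    rw [sign_extendPair, Fin.prod_univ_succ]
    have hz : extendPair e ⟨2 * ((0 : Fin (N + 1)) : ℕ), by simp⟩ = ⟨0, by omega⟩ :=
      extendPair_zero e
    have ho : extendPair e ⟨2 * ((0 : Fin (N + 1)) : ℕ) + 1, by simp; omega⟩ = ⟨1, by omega⟩ :=
      extendPair_one e
    rw [hz, ho]
    have : ∀ l : Fin N, C (extendPair e ⟨2 * (l.succ : Fin (N + 1)), by omega⟩)
        (extendPair e ⟨2 * (l.succ : Fin (N + 1)) + 1, by omega⟩) =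
        C (e ⟨2 * l, by omega⟩ + 2) (e ⟨2 * l + 1, by omega⟩ + 2) := fun l => by
      have h0 : extendPair e ⟨2 * (l.succ : Fin (N + 1)), by omega⟩ =
        ⟨e ⟨2 * l, by omega⟩ + 2, by omega⟩ := extendPair_add_two e (2 * l) (by omega)
      have h1 : extendPair e ⟨2 * (l.succ : Fin (N + 1)) + 1, by omega⟩ =
        ⟨e ⟨2 * l + 1, by omega⟩ + 2, by omega⟩ := extendPair_add_two e (2 * l + 1) (by omega)
      rw [h0, h1]
    rw [Finset.prod_congr rfl fun l _ => this l]
    ring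

theorem pfRest_eq_zero {N : ℕ} {C : ℕ → ℕ → ℝ} (h : ∀ j, 2 ≤ j → C 0 j = 0) :
    pfRest N C = 0 := by
  classical
  refine Finset.sum_eq_zero fun σ hσ => ?_
  simp only [Finset.mem_filter, Finset.mem_univ, true_and] at hσ
  unfold pfTerm
  refine mul_eq_zero_of_right _ (Finset.prod_eq_zero (Finset.mem_univ 0) ?_)
  have hz : σ ⟨2 * ((0 : Fin (N + 1)) : ℕ), by simp⟩ = ⟨0, by omega⟩ := hσ.1.apply_zero
  have ho : σ ⟨2 * ((0 : Fin (N + 1)) : ℕ) + 1, by simp; omega⟩ = σ ⟨1, by omega⟩ := rfl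
  rw [hz, ho]
  refine h _ ?_
  have h0 : (σ ⟨1, by omega⟩ : ℕ) ≠ 0 := fun h0 => by
    have h1 : σ ⟨1, by omega⟩ = σ ⟨0, by omega⟩ := by
      rw [hσ.1.apply_zero]
      exact Fin.ext h0
    simpa using σ.injective h1
  have h1 : (σ ⟨1, by omega⟩ : ℕ) ≠ 1 := fun h1 => hσ.2 (Fin.ext h1)
  omega

theorem pfRest_congr {N : ℕ} {C D : ℕ → ℕ → ℝ}
    (h : ∀ i j, ¬(i = 0 ∧ j = 1) → C i j = D i j) : pfRest N C = pfRest N D := by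
  classical
  refine Finset.sum_congr rfl fun σ hσ => ?_
  simp only [Finset.mem_filter, Finset.mem_univ, true_and] at hσ
  unfold pfTerm
  congr 1
  refine Finset.prod_congr rfl fun l _ => h _ _ fun hij => ?_
  have h0 : σ ⟨2 * l, by omega⟩ = σ ⟨0, by omega⟩ := by
    rw [hσ.1.apply_zero]
    exact Fin.ext hij.1
  have h1 : l.1 = 0 := by simpa using σ.injective h0
  refine hσ.2 (Fin.ext ?_)
  have h2 : (⟨2 * l + 1, by omega⟩ : Fin (2 * (N + 1))) = ⟨1, by omega⟩ :=
    Fin.ext (by simp [h1])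
  exact (congrArg (fun i => (σ i : ℕ)) h2).symm.trans hij.2

/-! ### Gaussian elimination for Pfaffians -/

/-- The Pfaffian depends on its `(0, 1)` entry through an affine function whose slope is the
Pfaffian of the remaining rows. -/
theorem pfSeq_sub_of_eq_off_zero_one {N : ℕ} {C D : ℕ → ℕ → ℝ}
    (h : ∀ i j, ¬(i = 0 ∧ j = 1) → C i j = D i j) :
    pfSeq (N + 1) C - pfSeq (N + 1) D =
      (C 0 1 - D 0 1) * pfSeq N fun i j => D (i + 2) (j + 2) := by
  rw [pfSeq_succ, pfSeq_succ, pfRest_congr h,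
    pfSeq_congr fun i _ j _ => h (i + 2) (j + 2) (by omega)]
  ring

theorem pfSeq_zero (C : ℕ → ℕ → ℝ) : pfSeq 0 C = 1 := by
  classical
  have h : ∀ σ : Equiv.Perm (Fin (2 * 0)), IsCanonical σ := fun σ =>
    ⟨fun l => l.elim0, fun l => l.elim0⟩
  rw [pfSeq, pfaffian_eq_sum_canonical, Finset.filter_true_of_mem fun σ _ => h σ]
  have : Subsingleton (Equiv.Perm (Fin (2 * 0))) :=
    inferInstanceAs (Subsingleton (Equiv.Perm (Fin 0)))
  rw [Fintype.sum_eq_single 1 fun σ h => absurd (Subsingleton.elim σ 1) h]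
  simp [pfTerm]

theorem pfSeq_succ_of_row_eq_zero {N : ℕ} {C : ℕ → ℕ → ℝ}
    (h : ∀ j, 2 ≤ j → j < 2 * (N + 1) → C 0 j = 0) :
    pfSeq (N + 1) C = C 0 1 * pfSeq N fun i j => C (i + 2) (j + 2) := by
  -- Entries outside the block do not matter, and are replaced by zero.
  set D : ℕ → ℕ → ℝ := fun i j => if j < 2 * (N + 1) then C i j else 0 with hD
  have h1 : pfSeq (N + 1) C = pfSeq (N + 1) D :=
    pfSeq_congr fun i _ j hj => by simp [hD, hj]
  have h2 : pfSeq N (fun i j => C (i + 2) (j + 2)) = pfSeq N fun i j => D (i + 2) (j + 2) :=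
    pfSeq_congr fun i _ j hj => by simp [hD, show j + 2 < 2 * (N + 1) by omega]
  rw [h1, h2, pfSeq_succ, pfRest_eq_zero, add_zero]
  · simp only [hD]
    rw [if_pos (show 1 < 2 * (N + 1) by omega)]
  · intro j hj
    by_cases hj' : j < 2 * (N + 1)
    · simpa [hD, hj'] using h j hj hj'
    · simp [hD, hj']

theorem pfSeq_one (C : ℕ → ℕ → ℝ) : pfSeq 1 C = C 0 1 := by
  rw [pfSeq_succ_of_row_eq_zero fun j h1 h2 => by omega, pfSeq_zero, mul_one]

/-- Adding multiples of one argument to the others does not change an alternating map. -/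
theorem map_add_smul_of_eq_zero {ι E : Type*} [Fintype ι] [DecidableEq ι] [AddCommGroup E]
    [Module ℝ E] (f : E [⋀^ι]→ₗ[ℝ] ℝ) (v : ι → E) (j : ι) (c : ι → ℝ) (hc : c j = 0) :
    f (fun i => v i + c i • v j) = f v := by
  have key : ∀ s : Finset ι, f (fun i => if i ∈ s then v i + c i • v j else v i) = f v := by
    intro s
    induction s using Finset.induction_on with
    | empty => simp
    | insert a s ha ih =>
      set w : ι → E := fun i => if i ∈ s then v i + c i • v j else v i with hw
      have h1 : (fun i => if i ∈ insert a s then v i + c i • v j else v i) =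
          Function.update w a (w a + c a • v j) := by
        ext1 i
        rcases eq_or_ne i a with rfl | hi
        · simp [hw, ha]
        · simp [hw, hi]
      rw [h1, AlternatingMap.map_update_add, AlternatingMap.map_update_smul,
        Function.update_eq_self, ih]
      rcases eq_or_ne a j with rfl | haj
      · simp [hc]
      · rw [AlternatingMap.map_eq_zero_of_eq f (Function.update w a (v j)) (i := a) (j := j) _ haj]
        · simp
        · rw [Function.update_self, Function.update_of_ne haj.symm]
          simp [hw, hc]
  simpa using key Finset.univ

theorem pfSeq_gram {E : Type*} [AddCommGroup E] [Module ℝ E] {ω : E →ₗ[ℝ] E →ₗ[ℝ] ℝ}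
    (hω : ω.IsAlt) (N : ℕ) (w : ℕ → E) :
    pfSeq N (fun i j => ω (w i) (w j)) = pfAlt ω N fun i => w i :=
  (pfAlt_apply hω N _).symm

/-- The Schur complement of the pair of labels `p`, `q` in an array. -/
def schurCompl {L : Type*} (A : L → L → ℝ) (p q x y : L) : ℝ :=
  A x y - (A p x * A q y - A p y * A q x) / A p q

theorem schurCompl_skew {L : Type*} {A : L → L → ℝ} (hA : ∀ a c, A c a = -A a c) (p q : L) :
    ∀ a c, schurCompl A p q c a = -schurCompl A p q a c := by
  intro a c
  simp only [schurCompl, hA a c]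
  ring

/-- One step of Gaussian elimination: a pair of labels with non-zero entry splits off from the
Pfaffian. -/
theorem pfSeq_succ_eq_schurCompl {L : Type*} {A : L → L → ℝ} (hA : ∀ a c, A c a = -A a c)
    (N : ℕ) (u : ℕ → L) (h01 : A (u 0) (u 1) ≠ 0) :
    pfSeq (N + 1) (fun i j => A (u i) (u j)) = A (u 0) (u 1) *
      pfSeq N fun i j => schurCompl A (u 0) (u 1) (u (i + 2)) (u (j + 2)) := by
  set ω := labelForm A with hω
  set v : ℕ → L →₀ ℝ := fun i => Finsupp.single (u i) 1 with hv
  -- Subtracting multiples of `v 1` makes `v 2, v 3, …` orthogonal to `v 0`.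
  set c : ℕ → ℝ := fun i => if i < 2 then 0 else -(A (u 0) (u i) / A (u 0) (u 1)) with hc
  set w : ℕ → L →₀ ℝ := fun i => v i + c i • v 1 with hw
  have hvv : ∀ i j, ω (v i) (v j) = A (u i) (u j) := fun i j => labelForm_single A _ _
  have hAA : ∀ a, A a a = 0 := fun a => by have := hA a a; linarith
  have h1 : pfSeq (N + 1) (fun i j => A (u i) (u j)) =
      pfSeq (N + 1) fun i j => ω (w i) (w j) := by
    rw [pfSeq_labels hA, pfSeq_gram (labelForm_isAlt hA)]
    exact (map_add_smul_of_eq_zero (pfAlt ω (N + 1)) (fun i => v i) ⟨1, by omega⟩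
      (fun i => c i) (by simp [hc])).symm
  have hww : ∀ i j, ω (w i) (w j) = A (u i) (u j) + c j * A (u i) (u 1) +
      c i * A (u 1) (u j) := by
    intro i j
    simp [hw, hvv, hAA]
  have hc0 : c 0 = 0 := by simp [hc]
  have hc1 : c 1 = 0 := by simp [hc]
  have hc2 : ∀ i, c (i + 2) = -(A (u 0) (u (i + 2)) / A (u 0) (u 1)) := fun i => by simp [hc]
  rw [h1, pfSeq_succ_of_row_eq_zero]
  · congr 1
    · rw [hww, hc0, hc1]; ring
    · refine pfSeq_congr fun i _ j _ => ?_
      simp only [hww, hc2, schurCompl]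
      rw [hA (u 1) (u (i + 2))]
      ring
  · intro j hj _
    obtain ⟨j, rfl⟩ := Nat.exists_eq_add_of_le' hj
    rw [hww, hc0, hc2]
    field_simp
    ring

/-- Only the entries above the diagonal occur in the Pfaffian. -/
theorem pfSeq_congr_of_lt {N : ℕ} {C D : ℕ → ℕ → ℝ} (h : ∀ i j, i < j → C i j = D i j) :
    pfSeq N C = pfSeq N D := by
  classical
  rw [pfSeq, pfSeq, pfaffian_eq_sum_canonical, pfaffian_eq_sum_canonical]
  refine Finset.sum_congr rfl fun σ hσ => ?_
  unfold pfTerm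
  congr 1
  exact Finset.prod_congr rfl fun l _ => h _ _ ((Finset.mem_filter.1 hσ).2.1 l)

theorem pfSeq_two {L : Type*} {A : L → L → ℝ} (hA : ∀ a c, A c a = -A a c) (u : ℕ → L) :
    pfSeq 2 (fun i j => A (u i) (u j)) = A (u 0) (u 1) * A (u 2) (u 3) -
      A (u 0) (u 2) * A (u 1) (u 3) + A (u 0) (u 3) * A (u 1) (u 2) := by
  -- The formula is affine in the first entry, so that this entry may be taken to be `1`.
  set D : ℕ → ℕ → ℝ := fun i j =>
    if i = 0 ∧ j = 1 then 1 else if i = 1 ∧ j = 0 then -1 else A (u i) (u j) with hD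
  set D' : ℕ → ℕ → ℝ := fun i j => if i = 1 ∧ j = 0 then -1 else A (u i) (u j) with hD'
  have hDs : ∀ i j, D j i = -D i j := by
    intro i j
    by_cases h1 : i = 0 ∧ j = 1
    · simp [hD, h1.1, h1.2]
    · by_cases h2 : i = 1 ∧ j = 0
      · simp [hD, h2.1, h2.2]
      · simp only [hD, h1, h2, if_false]
        rw [if_neg (by tauto), if_neg (by tauto), hA]
  have h1 := pfSeq_sub_of_eq_off_zero_one (N := 1) (C := D') (D := D)
    fun i j hij => by simp only [hD, hD', hij, if_false]
  have h2 := pfSeq_succ_eq_schurCompl hDs 1 id (by simp [hD])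
  have h3 : pfSeq 2 (fun i j => A (u i) (u j)) = pfSeq 2 D' := by
    refine pfSeq_congr_of_lt fun i j hij => ?_
    simp only [hD']
    rw [if_neg (by omega)]
  rw [pfSeq_one] at h1 h2
  simp only [id] at h2
  rw [h2] at h1
  rw [h3]
  simp [hD, hD', schurCompl] at h1 ⊢
  linarith

/-- If all leading Pfaffians of the sequence `b_0, …, b_{2m-1}` are non-zero, eliminating these
labels factors every Pfaffian that starts with them. -/
theorem exists_pfSeq_add_eq {L : Type*} (m : ℕ) {A : L → L → ℝ} (hA : ∀ a c, A c a = -A a c)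
    (b : ℕ → L) (hne : ∀ j ≤ m, pfSeq j (fun i k => A (b i) (b k)) ≠ 0) :
    ∃ C : L → L → ℝ, (∀ a c, C c a = -C a c) ∧ ∀ (M : ℕ) (u : ℕ → L), (∀ i < 2 * m, u i = b i) →
      pfSeq (m + M) (fun i j => A (u i) (u j)) = pfSeq m (fun i j => A (b i) (b j)) *
        pfSeq M fun i j => C (u (i + 2 * m)) (u (j + 2 * m)) := by
  induction m generalizing A b with
  | zero => exact ⟨A, hA, fun M u _ => by simp [pfSeq_zero]⟩
  | succ m ih =>
    have h01 : A (b 0) (b 1) ≠ 0 := by simpa [pfSeq_one] using hne 1 (by omega)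
    obtain ⟨C, hC, h⟩ := ih (schurCompl_skew hA (b 0) (b 1)) (fun i => b (i + 2))
      fun j hj h0 => hne (j + 1) (by omega) (by
        rw [pfSeq_succ_eq_schurCompl hA j b h01, h0, mul_zero])
    refine ⟨C, hC, fun M u hu => ?_⟩
    have hu0 := hu 0 (by omega)
    have hu1 := hu 1 (by omega)
    have h2 := h M (fun i => u (i + 2)) fun i hi => hu (i + 2) (by omega)
    rw [show m + 1 + M = m + M + 1 by omega,
      pfSeq_succ_eq_schurCompl hA _ u (by rwa [hu0, hu1]), hu0, hu1, h2,
      pfSeq_succ_eq_schurCompl hA _ b h01, mul_assoc]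
    congr 3

/-- The first `k` terms of `b`, followed by the sequence `w`. -/
def appendSeq {L : Type*} (k : ℕ) (b w : ℕ → L) (i : ℕ) : L := if i < k then b i else w (i - k)

/-- The sequence `x, y, y, …`. -/
def seqTwo {L : Type*} (x y : L) : ℕ → L
  | 0 => x
  | _ + 1 => y

/-- The sequence `x, y, z, w, w, …`. -/
def seqFour {L : Type*} (x y z w : L) : ℕ → L
  | 0 => x
  | 1 => y
  | 2 => z
  | _ + 3 => w

/-- The quadratic relation between the Pfaffians `(b, x, y, z, w)`, `(b, x, y)` and `(b)`. -/
theorem pfSeq_mul_pfSeq_four {L : Type*} {A : L → L → ℝ} (hA : ∀ a c, A c a = -A a c) (m : ℕ)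
    (b : ℕ → L) (hne : ∀ j ≤ m, pfSeq j (fun i k => A (b i) (b k)) ≠ 0)
    {P : (ℕ → L) → ℕ → ℝ} (hP : P = fun u N => pfSeq N fun i j => A (u i) (u j))
    (x y z w : L) :
    P b m * P (appendSeq (2 * m) b (seqFour x y z w)) (m + 2) =
      P (appendSeq (2 * m) b (seqTwo x y)) (m + 1) * P (appendSeq (2 * m) b (seqTwo z w)) (m + 1) -
      P (appendSeq (2 * m) b (seqTwo x z)) (m + 1) * P (appendSeq (2 * m) b (seqTwo y w)) (m + 1) +
      P (appendSeq (2 * m) b (seqTwo x w)) (m + 1) *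
        P (appendSeq (2 * m) b (seqTwo y z)) (m + 1) := by
  obtain ⟨C, hC, h⟩ := exists_pfSeq_add_eq m hA b hne
  have hu : ∀ s : ℕ → L, ∀ i < 2 * m, appendSeq (2 * m) b s i = b i := fun s i hi => if_pos hi
  have hs : ∀ (s : ℕ → L) (i : ℕ), appendSeq (2 * m) b s (i + 2 * m) = s i := fun s i => by
    simp [appendSeq]
  have h2 : ∀ x y, P (appendSeq (2 * m) b (seqTwo x y)) (m + 1) = P b m * C x y := fun x y => by
    simp only [hP, h 1 _ (hu (seqTwo x y)), pfSeq_one, hs, seqTwo]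
  have h4 : P (appendSeq (2 * m) b (seqFour x y z w)) (m + 2) =
      P b m * (C x y * C z w - C x z * C y w + C x w * C y z) := by
    simp only [hP, h 2 _ (hu (seqFour x y z w)), hs]
    rw [pfSeq_two hC]
    simp only [seqFour]
  rw [h2, h2, h2, h2, h2, h2, h4]
  ring

/-- The quadratic relation between the Pfaffians with `2m + 2` and `2m + 4` labels that share the
labels `b` and `e`. -/
theorem pfSeq_two_mul_pfSeq_four {L : Type*} {A : L → L → ℝ} (hA : ∀ a c, A c a = -A a c) (m : ℕ)
    (b : ℕ → L) (hne : ∀ j ≤ m, pfSeq j (fun i k => A (b i) (b k)) ≠ 0)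
    {P : (ℕ → L) → ℕ → ℝ} (hP : P = fun u N => pfSeq N fun i j => A (u i) (u j))
    (e x y z w : L) :
    P (appendSeq (2 * m) b (seqTwo e x)) (m + 1) *
        P (appendSeq (2 * m) b (seqFour e y z w)) (m + 2) -
      P (appendSeq (2 * m) b (seqTwo e y)) (m + 1) *
        P (appendSeq (2 * m) b (seqFour e x z w)) (m + 2) +
      P (appendSeq (2 * m) b (seqTwo e z)) (m + 1) *
        P (appendSeq (2 * m) b (seqFour e x y w)) (m + 2) -
      P (appendSeq (2 * m) b (seqTwo e w)) (m + 1) *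
        P (appendSeq (2 * m) b (seqFour e x y z)) (m + 2) = 0 := by
  have h0 : P b m ≠ 0 := by rw [hP]; exact hne m le_rfl
  have h1 := pfSeq_mul_pfSeq_four hA m b hne hP e y z w
  have h2 := pfSeq_mul_pfSeq_four hA m b hne hP e x z w
  have h3 := pfSeq_mul_pfSeq_four hA m b hne hP e x y w
  have h4 := pfSeq_mul_pfSeq_four hA m b hne hP e x y z
  refine (mul_eq_zero.1 ?_).resolve_left h0
  set T := fun x y => P (appendSeq (2 * m) b (seqTwo x y)) (m + 1) with hT
  linear_combination T e x * h1 - T e y * h2 + T e z * h3 - T e w * h4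

/-! ### Schur's Pfaffian -/

/-- A Pfaffian is linear in each label. -/
theorem pfSeq_mul_mul {C : ℕ → ℕ → ℝ} (hC : ∀ i j, C j i = -C i j) (N : ℕ) (s : ℕ → ℝ) :
    pfSeq N (fun i j => s i * s j * C i j) = (∏ i ∈ Finset.range (2 * N), s i) * pfSeq N C := by
  have h1 := pfSeq_labels hC N id
  have h2 := pfSeq_gram (labelForm_isAlt hC) N fun i => s i • Finsupp.single i (1 : ℝ)
  have h3 := (pfAlt (labelForm C) N).map_smul_univ (fun i => s i)
    fun i => Finsupp.single (i : ℕ) (1 : ℝ)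
  rw [h3, Fin.prod_univ_eq_prod_range (fun i => s i), smul_eq_mul] at h2
  simp only [id] at h1
  rw [h1, ← h2]
  refine pfSeq_congr fun i _ j _ => ?_
  rw [map_smul, map_smul, LinearMap.smul_apply, labelForm_single, smul_eq_mul, smul_eq_mul]
  ring

/-- The product of `g i j` over all `i < j < k`. -/
def triProd (k : ℕ) (g : ℕ → ℕ → ℝ) : ℝ := ∏ j ∈ Finset.range k, ∏ i ∈ Finset.range j, g i j

theorem triProd_succ (k : ℕ) (g : ℕ → ℕ → ℝ) : triProd (k + 1) g =
    (∏ j ∈ Finset.range k, g 0 (j + 1)) * triProd k fun i j => g (i + 1) (j + 1) := by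
  rw [triProd, Finset.prod_range_succ', triProd, ← Finset.prod_mul_distrib]
  simp only [Finset.range_zero, Finset.prod_empty, mul_one]
  refine Finset.prod_congr rfl fun j _ => ?_
  rw [Finset.prod_range_succ', mul_comm]

/-- The entry `(y - x) / (x + y)` of Schur's Pfaffian. -/
def schurEntry (x y : ℝ) : ℝ := (y - x) / (x + y)

theorem schurEntry_skew (x y : ℝ) : schurEntry y x = -schurEntry x y := by
  rw [schurEntry, schurEntry, add_comm, ← neg_div, neg_sub]

/-- Schur's Pfaffian. The Schur complement of a pair of nodes `x 0`, `x 1` again consists of the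
entries `schurEntry`, multiplied by row and column factors, which allows induction. -/
theorem pfSeq_schurEntry (N : ℕ) (x : ℕ → ℝ)
    (hx : ∀ i < 2 * N, ∀ j < 2 * N, i ≠ j → x i + x j ≠ 0) :
    pfSeq N (fun i j => schurEntry (x i) (x j)) =
      triProd (2 * N) fun i j => schurEntry (x i) (x j) := by
  induction N generalizing x with
  | zero => simp [pfSeq_zero, triProd]
  | succ N ih =>
    rw [show 2 * (N + 1) = 2 * N + 1 + 1 by ring, triProd_succ, triProd_succ]
    rcases eq_or_ne (x 0) (x 1) with h01 | h01
    · rw [pfSeq_eq_zero_of_eq (fun a c => schurEntry_skew a c) x (i := 0) (j := 1)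
        (by omega) (by omega) (by omega) h01, Finset.prod_range_succ']
      simp [schurEntry, h01]
    · have hs01 : schurEntry (x 0) (x 1) ≠ 0 :=
        div_ne_zero (sub_ne_zero.2 h01.symm) (hx 0 (by omega) 1 (by omega) (by omega))
      set s : ℕ → ℝ := fun i => schurEntry (x 0) (x (i + 2)) * schurEntry (x 1) (x (i + 2)) with hs
      have hcongr : pfSeq N (fun i j => schurCompl schurEntry (x 0) (x 1) (x (i + 2)) (x (j + 2))) =
          pfSeq N fun i j => s i * s j * schurEntry (x (i + 2)) (x (j + 2)) := by
        refine pfSeq_congr fun i hi j hj => ?_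
        rcases eq_or_ne i j with rfl | hij
        · simp [schurCompl, schurEntry]
        · have hij' := hx (i + 2) (by omega) (j + 2) (by omega) (by omega)
          have h0i := hx 0 (by omega) (i + 2) (by omega) (by omega)
          have h1i := hx 1 (by omega) (i + 2) (by omega) (by omega)
          have h0j := hx 0 (by omega) (j + 2) (by omega) (by omega)
          have h1j := hx 1 (by omega) (j + 2) (by omega) (by omega)
          have h := hx 0 (by omega) 1 (by omega) (by omega)
          have h10 := sub_ne_zero.2 h01.symm
          simp only [schurCompl, schurEntry, hs]
          field_simp
          ring
      rw [pfSeq_succ_eq_schurCompl (fun a c => schurEntry_skew a c) N x hs01, hcongr,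
        pfSeq_mul_mul (fun i j => schurEntry_skew _ _),
        ih (fun i => x (i + 2)) fun i hi j hj hij =>
          hx (i + 2) (by omega) (j + 2) (by omega) (by omega),
        Finset.prod_range_succ', hs, Finset.prod_mul_distrib]
      simp only [zero_add, add_assoc, Nat.reduceAdd]
      ring

/-! ### Derivatives of Pfaffians -/

open Classical in
/-- The derivative of the Pfaffian at the array `C` in the direction `H`. -/
def pfDeriv (N : ℕ) (C H : ℕ → ℕ → ℝ) : ℝ :=
  ∑ σ : Equiv.Perm (Fin (2 * N)) with IsCanonical σ, ((Equiv.Perm.sign σ : ℤ) : ℝ) *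
    ∑ l : Fin N, (∏ k ∈ Finset.univ.erase l,
      C (σ ⟨2 * k, by omega⟩) (σ ⟨2 * k + 1, by omega⟩)) *
        H (σ ⟨2 * l, by omega⟩) (σ ⟨2 * l + 1, by omega⟩)

theorem hasDerivAt_pfSeq {N : ℕ} {C : ℝ → ℕ → ℕ → ℝ} {H : ℕ → ℕ → ℝ} {t : ℝ}
    (h : ∀ i < 2 * N, ∀ j < 2 * N, HasDerivAt (fun s => C s i j) (H i j) t) :
    HasDerivAt (fun s => pfSeq N (C s)) (pfDeriv N (C t) H) t := by
  classical
  simp only [pfSeq, pfaffian_eq_sum_canonical, pfTerm]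
  refine HasDerivAt.fun_sum fun σ _ => HasDerivAt.const_mul _ ?_
  have := HasDerivAt.fun_finsetProd (u := Finset.univ)
    (f := fun (l : Fin N) s => C s (σ ⟨2 * l, by omega⟩) (σ ⟨2 * l + 1, by omega⟩))
    (f' := fun l => H (σ ⟨2 * l, by omega⟩) (σ ⟨2 * l + 1, by omega⟩)) (x := t)
    fun l _ => h _ (σ ⟨2 * l, by omega⟩).2 _ (σ ⟨2 * l + 1, by omega⟩).2
  simpa using this

theorem pfDeriv_add (N : ℕ) (C H K : ℕ → ℕ → ℝ) :
    pfDeriv N C (fun i j => H i j + K i j) = pfDeriv N C H + pfDeriv N C K := by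
  simp only [pfDeriv, mul_add, Finset.sum_add_distrib]

theorem pfDeriv_smul (N : ℕ) (C H : ℕ → ℕ → ℝ) (c : ℝ) :
    pfDeriv N C (fun i j => c * H i j) = c * pfDeriv N C H := by
  simp only [pfDeriv, Finset.mul_sum]
  refine Finset.sum_congr rfl fun σ _ => Finset.sum_congr rfl fun l _ => ?_
  ring

theorem pfDeriv_sum (N : ℕ) (C : ℕ → ℕ → ℝ) {ι : Type*} (R : Finset ι) (H : ι → ℕ → ℕ → ℝ) :
    pfDeriv N C (fun i j => ∑ r ∈ R, H r i j) = ∑ r ∈ R, pfDeriv N C (H r) := by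
  classical
  induction R using Finset.induction_on with
  | empty => simp [pfDeriv]
  | insert a R ha ih =>
    rw [Finset.sum_insert ha, ← ih, ← pfDeriv_add]
    simp only [Finset.sum_insert ha]

/-- Euler's relation: the Pfaffian is homogeneous of degree `N`. -/
theorem pfDeriv_self (N : ℕ) (C : ℕ → ℕ → ℝ) : pfDeriv N C C = N * pfSeq N C := by
  classical
  rw [pfSeq, pfaffian_eq_sum_canonical, pfDeriv, Finset.mul_sum]
  refine Finset.sum_congr rfl fun σ _ => ?_
  rw [Finset.sum_congr rfl fun l _ => Finset.prod_erase_mul _ _ (Finset.mem_univ l), pfTerm]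
  simp
  ring

/-- Along a line on which the Pfaffian is affine, `pfDeriv` is its slope. -/
theorem pfDeriv_eq_of_affine {N : ℕ} {C H : ℕ → ℕ → ℝ} {p q : ℝ}
    (h : ∀ ε : ℝ, pfSeq N (fun i j => C i j + ε * H i j) = p + ε * q) : pfDeriv N C H = q := by
  have h1 : HasDerivAt (fun ε : ℝ => pfSeq N fun i j => C i j + ε * H i j)
      (pfDeriv N (fun i j => C i j + 0 * H i j) H) 0 :=
    hasDerivAt_pfSeq fun i _ j _ => by
      simpa using ((hasDerivAt_id (0 : ℝ)).mul_const (H i j)).const_add (C i j)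
  have h2 : HasDerivAt (fun ε : ℝ => p + ε * q) q 0 := by
    simpa using ((hasDerivAt_id (0 : ℝ)).mul_const q).const_add p
  simp only [h, zero_mul, add_zero] at h1
  exact h1.unique h2

/-- The variation of the array `A (u i) (u j)` when the label `u r` is varied in the
direction `x`. -/
def rowVar {L : Type*} (A : L → L → ℝ) (u : ℕ → L) (r : ℕ) (x : L) (i j : ℕ) : ℝ :=
  (if i = r then A x (u j) else 0) + if j = r then A (u i) x else 0

/-- A Pfaffian is linear in each label, so that varying one label replaces it by its variation. -/
theorem pfDeriv_rowVar {L : Type*} {A : L → L → ℝ} (hA : ∀ a c, A c a = -A a c) (N : ℕ)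
    (u : ℕ → L) (r : ℕ) (hr : r < 2 * N) (x : L) :
    pfDeriv N (fun i j => A (u i) (u j)) (rowVar A u r x) =
      pfSeq N fun i j => A (Function.update u r x i) (Function.update u r x j) := by
  refine pfDeriv_eq_of_affine (p := pfSeq N fun i j => A (u i) (u j)) fun ε => ?_
  set v : Fin (2 * N) → L →₀ ℝ := fun i => Finsupp.single (u i) 1 with hv
  have hxx : A x x = 0 := by have := hA x x; linarith
  have h1 : pfSeq N (fun i j => A (u i) (u j) + ε * rowVar A u r x i j) =
      pfAlt (labelForm A) N (Function.update v ⟨r, hr⟩ (v ⟨r, hr⟩ + ε • Finsupp.single x 1)) := by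
    rw [pfAlt_apply (labelForm_isAlt hA), pfSeq]
    congr 1
    ext i j
    have hupd : ∀ k : Fin (2 * N),
        Function.update v ⟨r, hr⟩ (v ⟨r, hr⟩ + ε • Finsupp.single x 1) k =
          v k + (if (k : ℕ) = r then ε else 0) • Finsupp.single x 1 := by
      intro k
      by_cases hk : (k : ℕ) = r
      · obtain rfl : k = ⟨r, hr⟩ := Fin.ext hk
        simp
      · rw [Function.update_of_ne fun h => hk (congrArg Fin.val h)]
        simp [hk]
    rw [hupd, hupd]
    simp only [map_add, map_smul, LinearMap.add_apply, LinearMap.smul_apply, hv,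
      labelForm_single, hxx, smul_eq_mul, rowVar]
    split_ifs <;> ring
  have h2 : (fun i : Fin (2 * N) => Finsupp.single (Function.update u r x i) (1 : ℝ)) =
      Function.update v ⟨r, hr⟩ (Finsupp.single x 1) := by
    ext1 k
    by_cases hk : (k : ℕ) = r
    · obtain rfl : k = ⟨r, hr⟩ := Fin.ext hk
      simp
    · rw [Function.update_of_ne fun h => hk (congrArg Fin.val h), Function.update_of_ne hk]
  rw [h1, AlternatingMap.map_update_add, AlternatingMap.map_update_smul, Function.update_eq_self,
    pfSeq_labels hA, pfSeq_labels hA, h2, smul_eq_mul]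

/-- Adding a multiple of the rank two array `A p (u i) * A q (u j) - A p (u j) * A q (u i)` to a
Pfaffian amounts to adjoining the two labels `p` and `q`. -/
theorem pfSeq_add_wedge {L : Type*} {A : L → L → ℝ} (hA : ∀ a c, A c a = -A a c) (N : ℕ)
    (u : ℕ → L) (p q : L) (hpq : A p q = 0) (w : ℕ → L) (hw0 : w 0 = p) (hw1 : w 1 = q)
    (hw : ∀ i, w (i + 2) = u i) (ε : ℝ) :
    pfSeq N (fun i j => A (u i) (u j) +
      ε * (A p (u i) * A q (u j) - A p (u j) * A q (u i))) =
      pfSeq N (fun i j => A (u i) (u j)) +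
        ε * -pfSeq (N + 1) fun i j => A (w i) (w j) := by
  rcases eq_or_ne ε 0 with rfl | hε
  · simp
  -- With `-1 / ε` as the pairing of `p` and `q`, the Schur complement of this pair is the
  -- array on the left.
  set s : ℝ := -1 / ε with hs
  have hs0 : s ≠ 0 := div_ne_zero (by norm_num) hε
  set D : ℕ → ℕ → ℝ := fun i j =>
    if i = 0 ∧ j = 1 then s else if i = 1 ∧ j = 0 then -s else A (w i) (w j) with hD
  have hDs : ∀ i j, D j i = -D i j := by
    intro i j
    by_cases h1 : i = 0 ∧ j = 1
    · simp [hD, h1.1, h1.2]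
    · by_cases h2 : i = 1 ∧ j = 0
      · simp [hD, h2.1, h2.2]
      · simp only [hD, h1, h2, if_false]
        rw [if_neg (by tauto), if_neg (by tauto), hA]
  set D' : ℕ → ℕ → ℝ := fun i j => if i = 0 ∧ j = 1 then s else A (w i) (w j) with hD'
  have h1 := pfSeq_sub_of_eq_off_zero_one (N := N) (C := D') (D := fun i j => A (w i) (w j))
    fun i j hij => by simp only [hD', hij, if_false]
  have h2 := pfSeq_succ_eq_schurCompl hDs N id (by simpa [hD] using hs0)
  have h3 : pfSeq (N + 1) (fun i j => D (id i) (id j)) = pfSeq (N + 1) D' := by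
    refine pfSeq_congr_of_lt fun i j hij => ?_
    simp only [hD, hD', id]
    congr 1
    rw [if_neg (by omega)]
  have h4 : pfSeq N (fun i j => schurCompl D (id 0) (id 1) (id (i + 2)) (id (j + 2))) =
      pfSeq N fun i j => A (u i) (u j) + ε * (A p (u i) * A q (u j) - A p (u j) * A q (u i)) := by
    refine pfSeq_congr fun i _ j _ => ?_
    simp only [schurCompl, hD, id]
    have hsε : s⁻¹ = -ε := by rw [hs]; field_simp
    simp [hw0, hw1, hw, div_eq_mul_inv, hsε]
    ring
  have h5 : D (id 0) (id 1) = s := by simp [hD]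
  have h6 : D' 0 1 - A (w 0) (w 1) = s := by simp [hD', hw0, hw1, hpq]
  rw [h3, h4, h5] at h2
  rw [h6, h2] at h1
  simp only [hw] at h1
  have h7 : ε * s = -1 := by rw [hs]; field_simp
  linear_combination (-ε) * h1 + (pfSeq N (fun i j => A (u i) (u j) +
      ε * (A p (u i) * A q (u j) - A p (u j) * A q (u i))) -
      pfSeq N fun i j => A (u i) (u j)) * h7

/-- The infinitesimal form of `pfSeq_add_wedge`, with the two adjoined labels at the end. -/
theorem pfDeriv_wedge {L : Type*} {A : L → L → ℝ} (hA : ∀ a c, A c a = -A a c) (N : ℕ)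
    (u : ℕ → L) (p q : L) (hpq : A p q = 0) :
    pfDeriv N (fun i j => A (u i) (u j))
      (fun i j => A p (u i) * A q (u j) - A p (u j) * A q (u i)) =
      -pfSeq (N + 1) fun i j =>
        A (appendSeq (2 * N) u (seqTwo p q) i) (appendSeq (2 * N) u (seqTwo p q) j) := by
  set w : ℕ → L := fun i => match i with
    | 0 => p
    | 1 => q
    | i + 2 => u i with hw
  set w' : ℕ → L := fun i => if i ≤ 2 * N then w (i + 1) else p with hw'
  have h1 := pfSeq_rotate hA N w w' (by simp [hw', hw]) fun i hi => by simp [hw', hi]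
  have h2 := pfSeq_rotate hA N w' (appendSeq (2 * N) u (seqTwo p q))
    (by simp [appendSeq, hw', hw, seqTwo]) fun i hi => by
      rcases Nat.lt_or_ge i (2 * N) with h | h
      · simp [appendSeq, hw', hw, h, Nat.succ_le_of_lt h]
      · obtain rfl : i = 2 * N := le_antisymm hi h
        simp [appendSeq, hw', seqTwo]
  rw [h2, h1, neg_neg]
  exact pfDeriv_eq_of_affine fun ε =>
    pfSeq_add_wedge hA N u p q hpq w rfl rfl (fun i => rfl) ε

/-! ### Expansion of an alternating map in Vandermonde determinants -/

/-- The expansion of an alternating map at the vectors `∑_j ζ_j^i c_j e_j`, symmetrized over the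
permutations of the summation indices. -/
theorem factorial_mul_map_sum_pow {k n : ℕ} {E : Type*} [AddCommGroup E] [Module ℝ E]
    (f : E [⋀^Fin k]→ₗ[ℝ] ℝ) (e : Fin n → E) (ζ c : Fin n → ℝ) :
    (k.factorial : ℝ) * f (fun i => ∑ j, (ζ j ^ (i : ℕ) * c j) • e j) =
      ∑ φ : Fin k → Fin n, (∏ i, c (φ i)) *
        (Matrix.vandermonde (ζ ∘ φ)).det * f (e ∘ φ) := by
  have h1 : f (fun i => ∑ j, (ζ j ^ (i : ℕ) * c j) • e j) =
      ∑ φ : Fin k → Fin n, (∏ i, ζ (φ i) ^ (i : ℕ)) * (∏ i, c (φ i)) * f (e ∘ φ) := by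
    have := f.toMultilinearMap.map_sum (fun (i : Fin k) (j : Fin n) => (ζ j ^ (i : ℕ) * c j) • e j)
    refine this.trans (Finset.sum_congr rfl fun φ _ => ?_)
    have h2 := f.map_smul_univ (fun i => ζ (φ i) ^ (i : ℕ) * c (φ i)) (fun i => e (φ i))
    rw [Finset.prod_mul_distrib] at h2
    exact h2
  have h2 : ∀ σ : Equiv.Perm (Fin k), f (fun i => ∑ j, (ζ j ^ (i : ℕ) * c j) • e j) =
      ∑ φ : Fin k → Fin n, ((Equiv.Perm.sign σ : ℤ) : ℝ) * (∏ i, ζ (φ (σ i)) ^ (i : ℕ)) *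
        ((∏ i, c (φ i)) * f (e ∘ φ)) := by
    intro σ
    rw [h1, ← Equiv.sum_comp (Equiv.arrowCongr σ (Equiv.refl (Fin n))).symm]
    refine Finset.sum_congr rfl fun φ _ => ?_
    have h3 := f.map_perm (e ∘ φ) σ
    rw [Units.smul_def, zsmul_eq_mul] at h3
    have h4 : ∏ i, c (φ (σ i)) = ∏ i, c (φ i) := Equiv.prod_comp σ fun i => c (φ i)
    have h5 : (Equiv.arrowCongr σ (Equiv.refl (Fin n))).symm φ = φ ∘ σ := rfl
    rw [h5]
    simp only [Function.comp_apply]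
    rw [h4, ← Function.comp_assoc, h3]
    ring
  have h6 : (k.factorial : ℝ) * f (fun i => ∑ j, (ζ j ^ (i : ℕ) * c j) • e j) =
      ∑ _σ : Equiv.Perm (Fin k), f (fun i => ∑ j, (ζ j ^ (i : ℕ) * c j) • e j) := by
    rw [Finset.sum_const, Finset.card_univ, Fintype.card_perm, Fintype.card_fin, nsmul_eq_mul]
  rw [h6, Finset.sum_congr rfl fun σ _ => h2 σ, Finset.sum_comm]
  refine Finset.sum_congr rfl fun φ _ => ?_
  rw [← Finset.sum_mul, Matrix.det_apply]
  simp only [Matrix.vandermonde_apply, Function.comp_apply, Units.smul_def, zsmul_eq_mul]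
  ring

theorem prod_Ioi_eq_triProd (k : ℕ) (g : ℕ → ℕ → ℝ) :
    ∏ i : Fin k, ∏ j ∈ Finset.Ioi i, g i j = triProd k g := by
  induction k generalizing g with
  | zero => simp [triProd]
  | succ k ih =>
    rw [Fin.prod_univ_succ, Fin.prod_Ioi_zero, triProd_succ, ← ih,
      ← Fin.prod_univ_eq_prod_range fun j => g 0 (j + 1)]
    simp [Fin.prod_Ioi_succ]

/-! ### The double integrals -/

theorem measurableSet_wedge (t : ℝ) : MeasurableSet (wedge t) :=
  (measurableSet_lt measurable_fst measurable_snd).inter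
    (measurableSet_lt measurable_snd measurable_const)

theorem integrableOn_wedge_exp_mul_exp {a c : ℝ} (ha : 0 < a) (hc : 0 < c) (t : ℝ) :
    IntegrableOn (fun x : ℝ × ℝ => Real.exp (a * x.1) * Real.exp (c * x.2)) (wedge t) := by
  have h : IntegrableOn (fun x : ℝ × ℝ => Real.exp (a * x.1) * Real.exp (c * x.2))
      (Set.Iic t ×ˢ Set.Iic t) := by
    rw [IntegrableOn, Measure.volume_eq_prod, ← Measure.prod_restrict]
    exact (integrableOn_exp_mul_Iic ha t).mul_prod (integrableOn_exp_mul_Iic hc t)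
  exact h.mono_set fun x hx => ⟨(hx.1.trans hx.2).le, hx.2.le⟩

/-- The double integral of a product of exponentials, by integrating first over `t₁ < t₂`. -/
theorem integral_wedge_exp_mul_exp {a c : ℝ} (ha : 0 < a) (hc : 0 < c) (t : ℝ) :
    ∫ x in wedge t, Real.exp (a * x.1) * Real.exp (c * x.2) =
      Real.exp ((a + c) * t) / (a * (a + c)) := by
  have hint := (integrableOn_wedge_exp_mul_exp ha hc t).integrable_indicator
    (measurableSet_wedge t)
  rw [← integral_indicator (measurableSet_wedge t), Measure.volume_eq_prod,
    integral_prod_symm _ (by rwa [← Measure.volume_eq_prod])]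
  have hinner : ∀ y : ℝ, (∫ x : ℝ, (wedge t).indicator
      (fun x : ℝ × ℝ => Real.exp (a * x.1) * Real.exp (c * x.2)) (x, y)) =
      (Set.Iio t).indicator (fun y => Real.exp ((a + c) * y) / a) y := by
    intro y
    by_cases hy : y < t
    · have h1 : (fun x : ℝ => (wedge t).indicator
          (fun x : ℝ × ℝ => Real.exp (a * x.1) * Real.exp (c * x.2)) (x, y)) =
          (Set.Iio y).indicator fun x => Real.exp (a * x) * Real.exp (c * y) := by
        ext x
        simp [Set.indicator, wedge, hy]
      rw [h1, integral_indicator measurableSet_Iio, integral_mul_const,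
        ← integral_Iic_eq_integral_Iio, integral_exp_mul_Iic ha,
        Set.indicator_of_mem (show y ∈ Set.Iio t from hy), add_mul, Real.exp_add]
      ring
    · have h1 : (fun x : ℝ => (wedge t).indicator
          (fun x : ℝ × ℝ => Real.exp (a * x.1) * Real.exp (c * x.2)) (x, y)) = fun _ => 0 := by
        ext x
        simp [Set.indicator, wedge, hy]
      rw [h1, integral_zero, Set.indicator_of_notMem (show y ∉ Set.Iio t from hy)]
  simp only [hinner]
  rw [integral_indicator measurableSet_Iio, integral_div, ← integral_Iic_eq_integral_Iio,
    integral_exp_mul_Iic (add_pos ha hc)]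
  field_simp

variable {n : ℕ}

/-- The function `b_j(t) = b_j(0) e^{ζ_j t}`. -/
def expWeight (ζ b : Fin n → ℝ) (t : ℝ) (j : Fin n) : ℝ := b j * Real.exp (ζ j * t)

theorem moment_eq (ζ b : Fin n → ℝ) (i : ℕ) (t : ℝ) :
    moment ζ b i t = ∑ k, ζ k ^ i * expWeight ζ b t k := rfl

theorem entryIntegrand_eq (α : ℝ) (ζ b : Fin n → ℝ) (i j : ℕ) (x : ℝ × ℝ) :
    entryIntegrand α ζ b i j x = ∑ k, ∑ l, (ζ k ^ (i + 1) * b k * (ζ l ^ (j + 1) * b l)) *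
      (Real.exp (ζ k * x.1) * Real.exp ((α + ζ l) * x.2) -
        Real.exp (ζ l * x.1) * Real.exp ((α + ζ k) * x.2)) := by
  simp only [entryIntegrand, moment]
  rw [Finset.sum_mul_sum, Finset.sum_mul_sum, ← Finset.sum_sub_distrib, Finset.mul_sum]
  refine Finset.sum_congr rfl fun k _ => ?_
  rw [← Finset.sum_sub_distrib, Finset.mul_sum]
  refine Finset.sum_congr rfl fun l _ => ?_
  rw [add_mul, add_mul, Real.exp_add, Real.exp_add]
  ring

theorem integrableOn_entryIntegrand {α : ℝ} (hα : 0 ≤ α) {ζ : Fin n → ℝ} (hζ : ∀ j, 0 < ζ j)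
    (b : Fin n → ℝ) (i j : ℕ) (t : ℝ) :
    IntegrableOn (entryIntegrand α ζ b i j) (wedge t) := by
  rw [funext (entryIntegrand_eq α ζ b i j)]
  refine integrable_finsetSum _ fun k _ => integrable_finsetSum _ fun l _ => ?_
  have hk := hζ k
  have hl := hζ l
  exact ((integrableOn_wedge_exp_mul_exp hk (by positivity : 0 < α + ζ l) t).sub
    (integrableOn_wedge_exp_mul_exp hl (by positivity : 0 < α + ζ k) t)).const_mul _

/-- The number `ζ_k + α / 2` of an index `k`; the additional index `none`, which stands for the
character `d₀`, has the number `0`. -/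
def node (α : ℝ) (ζ : Fin n → ℝ) : Option (Fin n) → ℝ
  | none => 0
  | some k => ζ k + α / 2

theorem schurEntry_node (α : ℝ) (ζ : Fin n → ℝ) (k l : Fin n) :
    schurEntry (node α ζ (some k)) (node α ζ (some l)) = (ζ l - ζ k) / (α + ζ k + ζ l) := by
  simp only [schurEntry, node]
  congr 1 <;> ring

/-- The closed form of the entries `(i, j)`. The inner integration divides by `ζ_k` or `ζ_l`, which
turns the exponents `i + 1`, `j + 1` in the integrand into the antisymmetric factor `ζ_l - ζ_k`. -/
theorem entry_num_num {α : ℝ} (hα : 0 ≤ α) {ζ : Fin n → ℝ} (hζ : ∀ j, 0 < ζ j)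
    (b : Fin n → ℝ) (t : ℝ) (i j : ℕ) :
    entry α ζ b t (.num i) (.num j) = ∑ k, ∑ l,
      (ζ k ^ i * expWeight ζ b t k) * (ζ l ^ j * expWeight ζ b t l) *
        schurEntry (node α ζ (some k)) (node α ζ (some l)) := by
  have hint : ∀ k l, IntegrableOn (fun x : ℝ × ℝ =>
      (ζ k ^ (i + 1) * b k * (ζ l ^ (j + 1) * b l)) *
      (Real.exp (ζ k * x.1) * Real.exp ((α + ζ l) * x.2) -
        Real.exp (ζ l * x.1) * Real.exp ((α + ζ k) * x.2))) (wedge t) := fun k l => by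
    have hk := hζ k
    have hl := hζ l
    exact ((integrableOn_wedge_exp_mul_exp hk (by positivity : 0 < α + ζ l) t).sub
      (integrableOn_wedge_exp_mul_exp hl (by positivity : 0 < α + ζ k) t)).const_mul _
  simp only [entry, entryIntegrand_eq]
  rw [integral_finsetSum _ fun k _ => integrable_finsetSum _ fun l _ => hint k l, Finset.mul_sum]
  refine Finset.sum_congr rfl fun k _ => ?_
  rw [integral_finsetSum _ fun l _ => hint k l, Finset.mul_sum]
  refine Finset.sum_congr rfl fun l _ => ?_
  have hk := hζ k
  have hl := hζ l
  have hαk : 0 < α + ζ k := by positivity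
  have hαl : 0 < α + ζ l := by positivity
  rw [integral_const_mul, integral_sub (integrableOn_wedge_exp_mul_exp hk hαl t)
    (integrableOn_wedge_exp_mul_exp hl hαk t), integral_wedge_exp_mul_exp hk hαl,
    integral_wedge_exp_mul_exp hl hαk, schurEntry_node, expWeight, expWeight,
    show (ζ k + (α + ζ l)) * t = α * t + (ζ k * t + ζ l * t) by ring,
    show (ζ l + (α + ζ k)) * t = α * t + (ζ k * t + ζ l * t) by ring,
    Real.exp_add, Real.exp_add, Real.exp_neg]
  have h1 : ζ k + (α + ζ l) ≠ 0 := by positivity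
  have h2 : ζ l + (α + ζ k) ≠ 0 := by positivity
  have h3 : α + ζ k + ζ l ≠ 0 := by positivity
  have h4 : α + ζ l + ζ k ≠ 0 := by positivity
  have h5 := (Real.exp_pos (α * t)).ne'
  rw [show ζ k + (α + ζ l) = α + ζ k + ζ l by ring, show ζ l + (α + ζ k) = α + ζ k + ζ l by ring]
  field_simp
  ring

theorem entry_skew {α : ℝ} (hα : 0 ≤ α) {ζ : Fin n → ℝ} (hζ : ∀ j, 0 < ζ j) (b : Fin n → ℝ)
    (t : ℝ) (x y : Label) : entry α ζ b t y x = -entry α ζ b t x y := by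
  cases x with
  | d0 => cases y <;> simp [entry]
  | num i =>
    cases y with
    | d0 => simp [entry]
    | num j =>
      rw [entry_num_num hα hζ, entry_num_num hα hζ, Finset.sum_comm, ← Finset.sum_neg_distrib]
      refine Finset.sum_congr rfl fun k _ => ?_
      rw [← Finset.sum_neg_distrib]
      refine Finset.sum_congr rfl fun l _ => ?_
      rw [schurEntry_skew]
      ring

/-! ### Positivity of the tau functions -/

theorem tau_two_mul (α : ℝ) (ζ b : Fin n → ℝ) (m : ℕ) (t : ℝ) :
    tau α ζ b (2 * m : ℕ) t =
      pfSeq m fun i j => entry α ζ b t (evenLabels i) (evenLabels j) := by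
  have h1 : ¬(((2 * m : ℕ) : ℤ) < 0) := by omega
  have h2 : Even ((2 * m : ℕ) : ℤ) := ⟨m, by push_cast; ring⟩
  rw [tau, if_neg h1, if_pos h2]
  have : ((2 * m : ℕ) : ℤ).toNat / 2 = m := by omega
  rw [this]
  rfl

theorem tau_two_mul_add_one (α : ℝ) (ζ b : Fin n → ℝ) (m : ℕ) (t : ℝ) :
    tau α ζ b (2 * m + 1 : ℕ) t =
      pfSeq (m + 1) fun i j => entry α ζ b t (oddLabels i) (oddLabels j) := by
  have h1 : ¬(((2 * m + 1 : ℕ) : ℤ) < 0) := by omega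
  have h2 : ¬Even ((2 * m + 1 : ℕ) : ℤ) := by
    rw [Int.not_even_iff_odd]
    exact ⟨m, by push_cast; ring⟩
  rw [tau, if_neg h1, if_neg h2]
  have : (((2 * m + 1 : ℕ) : ℤ).toNat + 1) / 2 = m + 1 := by omega
  rw [this]
  rfl

/-- The interaction factor `∏_{i<j} (ζ_{φ j} - ζ_{φ i})² / (α + ζ_{φ i} + ζ_{φ j})`. -/
def interaction (α : ℝ) (ζ : Fin n → ℝ) {k : ℕ} (φ : Fin k → Fin n) : ℝ :=
  ∏ i, ∏ j ∈ Finset.Ioi i, (ζ (φ j) - ζ (φ i)) ^ 2 / (α + ζ (φ i) + ζ (φ j))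

/-- The Vandermonde determinant and Schur's Pfaffian each contribute one factor
`ζ_{φ j} - ζ_{φ i}`. -/
theorem det_vandermonde_mul_prod (α : ℝ) (ζ : Fin n → ℝ) {k : ℕ} (φ : Fin k → Fin n) :
    (Matrix.vandermonde (ζ ∘ φ)).det * ∏ i, ∏ j ∈ Finset.Ioi i,
      schurEntry (node α ζ (some (φ i))) (node α ζ (some (φ j))) = interaction α ζ φ := by
  rw [Matrix.det_vandermonde, ← Finset.prod_mul_distrib]
  refine Finset.prod_congr rfl fun i _ => ?_
  rw [← Finset.prod_mul_distrib]
  refine Finset.prod_congr rfl fun j _ => ?_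
  rw [schurEntry_node, Function.comp_apply, Function.comp_apply]
  ring

/-- The form on the space spanned by the indices and the character `d₀`. -/
abbrev nodeForm (α : ℝ) (ζ : Fin n → ℝ) :
    (Option (Fin n) →₀ ℝ) →ₗ[ℝ] (Option (Fin n) →₀ ℝ) →ₗ[ℝ] ℝ :=
  labelForm fun a c => schurEntry (node α ζ a) (node α ζ c)

theorem nodeForm_isAlt (α : ℝ) (ζ : Fin n → ℝ) : (nodeForm α ζ).IsAlt :=
  labelForm_isAlt fun _ _ => schurEntry_skew _ _

/-- The vector of moments `∑_k ζ_k^i b_k(t) e_k` representing the character `i`. -/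
def momentVec (ζ b : Fin n → ℝ) (t : ℝ) (i : ℕ) : Option (Fin n) →₀ ℝ :=
  ∑ k, (ζ k ^ i * expWeight ζ b t k) • Finsupp.single (some k) 1

theorem nodeForm_momentVec {α : ℝ} (hα : 0 ≤ α) {ζ : Fin n → ℝ} (hζ : ∀ j, 0 < ζ j)
    (b : Fin n → ℝ) (t : ℝ) (i j : ℕ) :
    nodeForm α ζ (momentVec ζ b t i) (momentVec ζ b t j) =
      entry α ζ b t (.num i) (.num j) := by
  rw [entry_num_num hα hζ, momentVec, momentVec, LinearMap.map_sum₂]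
  refine Finset.sum_congr rfl fun k _ => ?_
  rw [map_sum]
  refine Finset.sum_congr rfl fun l _ => ?_
  rw [map_smul, map_smul, LinearMap.smul_apply, labelForm_single, smul_eq_mul, smul_eq_mul]
  ring

theorem nodeForm_single_none_momentVec {α : ℝ} (hα : 0 ≤ α) {ζ : Fin n → ℝ} (hζ : ∀ j, 0 < ζ j)
    (b : Fin n → ℝ) (t : ℝ) (i : ℕ) :
    nodeForm α ζ (Finsupp.single none 1) (momentVec ζ b t i) = moment ζ b i t := by
  rw [momentVec, map_sum, moment_eq]
  refine Finset.sum_congr rfl fun k _ => ?_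
  have hk := hζ k
  have : ζ k + α / 2 ≠ 0 := by positivity
  rw [map_smul, labelForm_single, smul_eq_mul]
  simp [schurEntry, node, this]

/-- The expansion of the tau functions into positive terms. -/
theorem factorial_mul_tau {α : ℝ} (hα : 0 ≤ α) {ζ : Fin n → ℝ} (hζ : ∀ j, 0 < ζ j)
    (b : Fin n → ℝ) (k : ℕ) (t : ℝ) :
    (k.factorial : ℝ) * tau α ζ b k t =
      ∑ φ : Fin k → Fin n, (∏ i, expWeight ζ b t (φ i)) * interaction α ζ φ := by
  -- The nodes of the indices `φ 0, φ 1, …`, as a sequence.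
  set y : (Fin k → Fin n) → ℕ → ℝ :=
    fun φ i => if h : i < k then node α ζ (some (φ ⟨i, h⟩)) else 0 with hy
  have hyφ : ∀ φ (i : Fin k), y φ i = node α ζ (some (φ i)) := fun φ i => by simp [hy]
  have hypos : ∀ φ i, i < k → 0 < y φ i := fun φ i hi => by
    have := hζ (φ ⟨i, hi⟩)
    simp only [hy, hi, dif_pos, node]
    positivity
  have htri : ∀ φ, (Matrix.vandermonde (ζ ∘ φ)).det *
      triProd k (fun i j => schurEntry (y φ i) (y φ j)) = interaction α ζ φ := fun φ => by
    rw [← prod_Ioi_eq_triProd, ← det_vandermonde_mul_prod]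
    simp only [hyφ]
  rcases Nat.even_or_odd' k with ⟨m, rfl | rfl⟩
  · have h1 : tau α ζ b (2 * m : ℕ) t = pfAlt (nodeForm α ζ) m fun i =>
        ∑ j, (ζ j ^ (i : ℕ) * expWeight ζ b t j) • Finsupp.single (some j) 1 := by
      rw [tau_two_mul, pfAlt_apply (nodeForm_isAlt α ζ)]
      refine congrArg (pfaffian m) (funext fun i => funext fun j => ?_)
      exact (nodeForm_momentVec hα hζ b t i j).symm
    rw [h1, factorial_mul_map_sum_pow _ (fun j => Finsupp.single (some j) 1)]
    refine Finset.sum_congr rfl fun φ _ => ?_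
    rw [mul_assoc, ← htri, ← pfSeq_schurEntry m (y φ) fun i hi j hj _ =>
      (add_pos (hypos φ i hi) (hypos φ j hj)).ne', pfAlt_apply (nodeForm_isAlt α ζ)]
    congr 2
    refine congrArg (pfaffian m) (funext fun i => funext fun j => ?_)
    simp [hyφ]
  · set f : (Option (Fin n) →₀ ℝ) [⋀^Fin (2 * m + 1)]→ₗ[ℝ] ℝ :=
      AlternatingMap.curryLeft (n := 2 * m + 1) (pfAlt (nodeForm α ζ) (m + 1))
        (Finsupp.single none 1) with hf
    have hfv : ∀ v, f v = pfaffian (m + 1) fun i j =>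
        nodeForm α ζ (Matrix.vecCons (n := 2 * m + 1) (Finsupp.single none 1) v i)
          (Matrix.vecCons (n := 2 * m + 1) (Finsupp.single none 1) v j) := fun v =>
      pfAlt_apply (nodeForm_isAlt α ζ) (m + 1) _
    have hnone : nodeForm α ζ (Finsupp.single none 1) (Finsupp.single none 1) = 0 :=
      nodeForm_isAlt α ζ _
    have h1 : tau α ζ b (2 * m + 1 : ℕ) t = f fun i =>
        ∑ j, (ζ j ^ (i : ℕ) * expWeight ζ b t j) • Finsupp.single (some j) 1 := by
      rw [tau_two_mul_add_one, hfv]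
      refine congrArg (pfaffian (m + 1)) (funext fun i => funext fun j => ?_)
      change Fin (2 * m + 1 + 1) at i j
      induction i using Fin.cases with
      | zero =>
        induction j using Fin.cases with
        | zero => exact hnone.symm
        | succ j => exact (nodeForm_single_none_momentVec hα hζ b t j).symm
      | succ i =>
        induction j using Fin.cases with
        | zero =>
          refine Eq.trans ?_ ((nodeForm_isAlt α ζ).neg (Finsupp.single none 1)
            (momentVec ζ b t i))
          rw [nodeForm_single_none_momentVec hα hζ]
          rfl
        | succ j => exact (nodeForm_momentVec hα hζ b t i j).symm
    rw [h1, factorial_mul_map_sum_pow _ (fun j => Finsupp.single (some j) 1)]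
    refine Finset.sum_congr rfl fun φ _ => ?_
    -- The character `d₀` enters Schur's Pfaffian as an additional node `0`.
    set z : ℕ → ℝ := fun i => match i with
      | 0 => 0
      | i + 1 => y φ i with hz
    have hz1 : ∀ i j, schurEntry (z (i + 1)) (z (j + 1)) = schurEntry (y φ i) (y φ j) :=
      fun i j => rfl
    have hz0 : ∀ j < 2 * m + 1, schurEntry (z 0) (z (j + 1)) = 1 := fun j hj => by
      simp [schurEntry, hz, (hypos φ j hj).ne']
    have h2 := pfSeq_schurEntry (m + 1) z fun i hi j hj hij => by
      rcases i with _ | i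
      · rcases j with _ | j
        · exact absurd rfl hij
        · simpa [hz] using (hypos φ j (by omega)).ne'
      · rcases j with _ | j
        · simpa [hz] using (hypos φ i (by omega)).ne'
        · exact (add_pos (hypos φ i (by omega)) (hypos φ j (by omega))).ne'
    rw [show 2 * (m + 1) = 2 * m + 1 + 1 by ring, triProd_succ,
      Finset.prod_eq_one fun j hj => hz0 j (Finset.mem_range.1 hj), one_mul] at h2
    simp only [hz1] at h2
    rw [mul_assoc, ← htri, ← h2, hfv]
    congr 2
    refine congrArg (pfaffian (m + 1)) (funext fun i => funext fun j => ?_)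
    change Fin (2 * m + 1 + 1) at i j
    induction i using Fin.cases with
    | zero =>
      induction j using Fin.cases with
      | zero => simp [schurEntry, hz, node]
      | succ j => simp [schurEntry, hz, node, hyφ]
    | succ i =>
      induction j using Fin.cases with
      | zero => simp [schurEntry, hz, node, hyφ]
      | succ j => simp [hz, hyφ]

theorem interaction_nonneg {α : ℝ} (hα : 0 ≤ α) {ζ : Fin n → ℝ} (hζ : ∀ j, 0 < ζ j) {k : ℕ}
    (φ : Fin k → Fin n) : 0 ≤ interaction α ζ φ :=
  Finset.prod_nonneg fun i _ => Finset.prod_nonneg fun j _ => by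
    have := hζ (φ i)
    have := hζ (φ j)
    positivity

theorem tau_pos {α : ℝ} (hα : 0 ≤ α) {ζ b : Fin n → ℝ} (hζ : ∀ j, 0 < ζ j)
    (hmono : StrictMono ζ) (hb : ∀ j, 0 < b j) {k : ℕ} (hk : k ≤ n) (t : ℝ) :
    0 < tau α ζ b k t := by
  have hw : ∀ j, 0 < expWeight ζ b t j := fun j => mul_pos (hb j) (Real.exp_pos _)
  have h := factorial_mul_tau hα hζ b k t
  have hpos : 0 < ∑ φ : Fin k → Fin n, (∏ i, expWeight ζ b t (φ i)) * interaction α ζ φ := by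
    -- The term of the injective map `Fin.castLE` is positive.
    refine Finset.sum_pos' (fun φ _ => mul_nonneg
      (Finset.prod_nonneg fun i _ => (hw _).le) (interaction_nonneg hα hζ φ))
      ⟨Fin.castLE hk, Finset.mem_univ _, mul_pos (Finset.prod_pos fun i _ => hw _) ?_⟩
    refine Finset.prod_pos fun i _ => Finset.prod_pos fun j hj => ?_
    have hij : ζ (Fin.castLE hk i) < ζ (Fin.castLE hk j) := hmono (by simpa using hj)
    have h1 := hζ (Fin.castLE hk i)
    have h2 := hζ (Fin.castLE hk j)
    have := sub_pos.2 hij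
    positivity
  rw [← h] at hpos
  exact pos_of_mul_pos_right hpos (Nat.cast_nonneg _)

/-- For `k > n` every `φ : Fin k → Fin n` has a repeated value, which makes its term vanish. -/
theorem tau_eq_zero {α : ℝ} (hα : 0 ≤ α) {ζ : Fin n → ℝ} (hζ : ∀ j, 0 < ζ j) (b : Fin n → ℝ)
    {k : ℕ} (hk : n < k) (t : ℝ) : tau α ζ b k t = 0 := by
  have h := factorial_mul_tau hα hζ b k t
  rw [Finset.sum_eq_zero] at h
  · exact (mul_eq_zero.1 h).resolve_left (Nat.cast_ne_zero.2 k.factorial_ne_zero)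
  · intro φ _
    obtain ⟨i, j, hij, he⟩ := Fintype.exists_ne_map_eq_of_card_lt φ (by simpa using hk)
    wlog hlt : i < j generalizing i j
    · exact this j i hij.symm he.symm (lt_of_le_of_ne (not_lt.1 hlt) hij.symm)
    refine mul_eq_zero_of_right _ (Finset.prod_eq_zero (Finset.mem_univ i)
      (Finset.prod_eq_zero (Finset.mem_Ioi.2 hlt) ?_))
    simp [he]

/-! ### Evolution of the entries and of the Pfaffians -/

theorem hasDerivAt_expWeight (ζ b : Fin n → ℝ) (t : ℝ) (k : Fin n) :
    HasDerivAt (fun s => expWeight ζ b s k) (ζ k * expWeight ζ b t k) t := by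
  have h := (((hasDerivAt_id t).const_mul (ζ k)).exp).const_mul (b k)
  refine h.congr_deriv ?_
  simp only [expWeight, id]
  ring

theorem hasDerivAt_moment (ζ b : Fin n → ℝ) (i : ℕ) (t : ℝ) :
    HasDerivAt (moment ζ b i) (moment ζ b (i + 1) t) t := by
  have h : HasDerivAt (fun s => ∑ k, ζ k ^ i * expWeight ζ b s k)
      (∑ k, ζ k ^ i * (ζ k * expWeight ζ b t k)) t :=
    HasDerivAt.fun_sum fun k _ => (hasDerivAt_expWeight ζ b t k).const_mul _
  refine h.congr_deriv ?_
  rw [moment_eq]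
  refine Finset.sum_congr rfl fun k _ => ?_
  ring

section

variable {α : ℝ} {ζ : Fin n → ℝ}

theorem hasDerivAt_entry (hα : 0 ≤ α) (hζ : ∀ j, 0 < ζ j) (b : Fin n → ℝ) (t : ℝ) (i j : ℕ) :
    HasDerivAt (fun s => entry α ζ b s (.num i) (.num j))
      (entry α ζ b t (.num (i + 1)) (.num j) + entry α ζ b t (.num i) (.num (j + 1))) t := by
  simp only [entry_num_num hα hζ]
  have h := HasDerivAt.fun_sum (u := Finset.univ) fun k (_ : k ∈ Finset.univ) =>
    HasDerivAt.fun_sum (u := Finset.univ) fun l (_ : l ∈ Finset.univ) =>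
      ((((hasDerivAt_expWeight ζ b t k).const_mul (ζ k ^ i)).mul
        ((hasDerivAt_expWeight ζ b t l).const_mul (ζ l ^ j))).mul_const
          (schurEntry (node α ζ (some k)) (node α ζ (some l))))
  refine h.congr_deriv ?_
  rw [← Finset.sum_add_distrib]
  refine Finset.sum_congr rfl fun k _ => ?_
  rw [← Finset.sum_add_distrib]
  refine Finset.sum_congr rfl fun l _ => ?_
  ring

/-- The second expression for the derivative of the entries: differentiating the upper limit of
the double integral leaves a product of moments. -/
theorem entry_succ_add_entry_succ (hα : 0 ≤ α) (hζ : ∀ j, 0 < ζ j) (b : Fin n → ℝ) (t : ℝ)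
    (i j : ℕ) :
    entry α ζ b t (.num (i + 1)) (.num j) + entry α ζ b t (.num i) (.num (j + 1)) =
      moment ζ b i t * moment ζ b (j + 1) t - moment ζ b j t * moment ζ b (i + 1) t -
        α * entry α ζ b t (.num i) (.num j) := by
  simp only [entry_num_num hα hζ, moment_eq]
  rw [mul_comm (∑ k, ζ k ^ j * expWeight ζ b t k), Finset.sum_mul_sum, Finset.sum_mul_sum,
    ← Finset.sum_add_distrib, Finset.mul_sum, ← Finset.sum_sub_distrib, ← Finset.sum_sub_distrib]
  refine Finset.sum_congr rfl fun k _ => ?_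
  rw [← Finset.sum_add_distrib, Finset.mul_sum, ← Finset.sum_sub_distrib,
    ← Finset.sum_sub_distrib]
  refine Finset.sum_congr rfl fun l _ => ?_
  have hk := hζ k
  have hl := hζ l
  have h3 : α + ζ k + ζ l ≠ 0 := by positivity
  rw [schurEntry_node]
  field_simp
  ring

/-- The entries extended by a further character `d₁ = none` with `(d₁, i) = f_{i+1}` and
`(d₀, d₁) = 0`. -/
def extEntry (α : ℝ) (ζ b : Fin n → ℝ) (t : ℝ) : Option Label → Option Label → ℝ
  | some x, some y => entry α ζ b t x y
  | none, some (.num j) => moment ζ b (j + 1) t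
  | some (.num i), none => -moment ζ b (i + 1) t
  | none, some .d0 => 0
  | some .d0, none => 0
  | none, none => 0

theorem extEntry_skew (hα : 0 ≤ α) (hζ : ∀ j, 0 < ζ j) (b : Fin n → ℝ) (t : ℝ)
    (x y : Option Label) : extEntry α ζ b t y x = -extEntry α ζ b t x y := by
  rcases x with _ | _ | i <;> rcases y with _ | _ | j <;>
    simp only [extEntry, neg_zero, neg_neg, ← entry_skew hα hζ b t]

/-- The numerical characters among the extended ones. -/
abbrev numLabel (i : ℕ) : Option Label := some (.num i)

/-- The Pfaffian `(u_0, …, u_{2N-1})` of extended characters at time `t`. -/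
def extPf (α : ℝ) (ζ b : Fin n → ℝ) (u : ℕ → Option Label) (N : ℕ) (t : ℝ) : ℝ :=
  pfSeq N fun i j => extEntry α ζ b t (u i) (u j)

theorem extPf_congr {b : Fin n → ℝ} {u w : ℕ → Option Label} {N : ℕ}
    (h : ∀ i < 2 * N, u i = w i) : extPf α ζ b u N = extPf α ζ b w N := by
  funext t
  exact pfSeq_congr fun i hi j hj => by rw [h i hi, h j hj]

theorem extPf_eq_tau_two_mul {b : Fin n → ℝ} {m : ℕ} {u : ℕ → Option Label}
    (hu : ∀ i < 2 * m, u i = numLabel i) : extPf α ζ b u m = tau α ζ b (2 * m : ℕ) := by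
  funext t
  rw [extPf_congr hu, tau_two_mul]
  rfl

/-- The sign comes from moving `d₀` past an odd number of characters. -/
theorem extPf_eq_neg_tau (hα : 0 ≤ α) (hζ : ∀ j, 0 < ζ j) {b : Fin n → ℝ} {m : ℕ}
    {u : ℕ → Option Label} (hu : ∀ i ≤ 2 * m, u i = numLabel i)
    (hd : u (2 * m + 1) = some .d0) :
    extPf α ζ b u (m + 1) = fun t => -tau α ζ b (2 * m + 1 : ℕ) t := by
  funext t
  rw [tau_two_mul_add_one]
  exact pfSeq_rotate (extEntry_skew hα hζ b t) m (fun i => some (oddLabels i)) u hd hu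

/-- Since `i ↦ i + 1` differentiates the moments, the derivative of `(0, …, k, d₀, …)` is obtained
by raising the last number, all other contributions having a repeated character. -/
theorem hasDerivAt_extPf_raise (hα : 0 ≤ α) (hζ : ∀ j, 0 < ζ j) (b : Fin n → ℝ) {N k : ℕ}
    (hk : k < 2 * N) {u w : ℕ → Option Label} (hu : ∀ i ≤ k, u i = numLabel i)
    (hd : ∀ i, k < i → i < 2 * N → u i = some .d0) (hwk : w k = numLabel (k + 1))
    (hw : ∀ i < 2 * N, i ≠ k → w i = u i) (t : ℝ) :
    HasDerivAt (extPf α ζ b u N) (extPf α ζ b w N t) t := by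
  set A := extEntry α ζ b t with hA
  have hskew := extEntry_skew hα hζ b t
  have h1 : HasDerivAt (extPf α ζ b u N) (pfDeriv N (fun i j => A (u i) (u j))
      fun i j => ∑ r ∈ Finset.range (k + 1), rowVar A u r (numLabel (r + 1)) i j) t := by
    refine hasDerivAt_pfSeq fun i hi j hj => ?_
    have h2 : ∑ r ∈ Finset.range (k + 1), rowVar A u r (numLabel (r + 1)) i j =
        (if i ≤ k then A (numLabel (i + 1)) (u j) else 0) +
          if j ≤ k then A (u i) (numLabel (j + 1)) else 0 := by
      simp [rowVar, Finset.sum_add_distrib, Finset.sum_ite_eq]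
    rw [h2]
    rcases le_or_gt i k with hik | hik
    · rcases le_or_gt j k with hjk | hjk
      · rw [if_pos hik, if_pos hjk, hu i hik, hu j hjk]
        exact hasDerivAt_entry hα hζ b t i j
      · rw [if_pos hik, if_neg (not_le.2 hjk), hu i hik, hd j hjk hj, add_zero]
        exact (hasDerivAt_moment ζ b i t).neg
    · rcases le_or_gt j k with hjk | hjk
      · rw [if_neg (not_le.2 hik), if_pos hjk, hd i hik hi, hu j hjk, zero_add]
        exact hasDerivAt_moment ζ b j t
      · rw [if_neg (not_le.2 hik), if_neg (not_le.2 hjk), hd i hik hi, hd j hjk hj, add_zero]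
        exact hasDerivAt_const t 0
  refine h1.congr_deriv ?_
  rw [pfDeriv_sum, Finset.sum_range_succ, Finset.sum_eq_zero, zero_add,
    pfDeriv_rowVar hskew N u k hk]
  · refine pfSeq_congr fun i hi j hj => ?_
    have hupd : ∀ i < 2 * N, Function.update u k (numLabel (k + 1)) i = w i := fun i hi => by
      rcases eq_or_ne i k with rfl | hik
      · rw [Function.update_self, hwk]
      · rw [Function.update_of_ne hik, hw i hi hik]
    rw [hupd i hi, hupd j hj]
  · intro r hr
    have hrk := Finset.mem_range.1 hr
    rw [pfDeriv_rowVar hskew N u r (by omega)]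
    refine pfSeq_eq_zero_of_eq hskew _ (i := r) (j := r + 1) (by omega) (by omega) (by omega) ?_
    rw [Function.update_self, Function.update_of_ne (by omega), hu (r + 1) (by omega)]

/-- The derivative of a Pfaffian of numbers, by adjoining the characters `d₀` and `d₁`. -/
theorem hasDerivAt_extPf_adjoin (hα : 0 ≤ α) (hζ : ∀ j, 0 < ζ j) (b : Fin n → ℝ) {N : ℕ}
    {u w : ℕ → Option Label} (hu : ∀ i < 2 * N, ∃ a, u i = numLabel a)
    (hw : ∀ i < 2 * N, w i = u i) (hw0 : w (2 * N) = some .d0) (hw1 : w (2 * N + 1) = none)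
    (t : ℝ) :
    HasDerivAt (extPf α ζ b u N)
      (-extPf α ζ b w (N + 1) t - N * α * extPf α ζ b u N t) t := by
  set A := extEntry α ζ b t with hA
  have hskew := extEntry_skew hα hζ b t
  have h1 : HasDerivAt (extPf α ζ b u N) (pfDeriv N (fun i j => A (u i) (u j))
      fun i j => (A (some .d0) (u i) * A none (u j) - A (some .d0) (u j) * A none (u i)) +
        (-α) * A (u i) (u j)) t := by
    refine hasDerivAt_pfSeq fun i hi j hj => ?_
    obtain ⟨a, ha⟩ := hu i hi
    obtain ⟨c, hc⟩ := hu j hj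
    rw [ha, hc]
    refine (hasDerivAt_entry hα hζ b t a c).congr_deriv ?_
    rw [entry_succ_add_entry_succ hα hζ]
    simp only [hA, extEntry, entry]
    ring
  refine h1.congr_deriv ?_
  rw [pfDeriv_add, pfDeriv_smul, pfDeriv_self, pfDeriv_wedge hskew N u _ _ rfl]
  have h2 : pfSeq (N + 1) (fun i j => A (appendSeq (2 * N) u (seqTwo (some .d0) none) i)
      (appendSeq (2 * N) u (seqTwo (some .d0) none) j)) = extPf α ζ b w (N + 1) t := by
    refine congrFun (extPf_congr fun i hi => ?_) t
    rcases lt_trichotomy i (2 * N) with h | rfl | h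
    · rw [hw i h, appendSeq, if_pos h]
    · simp [appendSeq, seqTwo, hw0]
    · obtain rfl : i = 2 * N + 1 := by omega
      simp [appendSeq, seqTwo, hw1]
  have h3 : pfSeq N (fun i j => A (u i) (u j)) = extPf α ζ b u N t := rfl
  rw [h2, h3]
  ring

/-- The derivative of a Pfaffian of numbers and `d₀`, by replacing `d₀` with `d₁`. -/
theorem hasDerivAt_extPf_replace (hα : 0 ≤ α) (hζ : ∀ j, 0 < ζ j) (b : Fin n → ℝ) {N : ℕ}
    {u w : ℕ → Option Label} (hu : ∀ i ≤ 2 * N, ∃ a, u i = numLabel a)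
    (hd : u (2 * N + 1) = some .d0) (hw : ∀ i ≤ 2 * N, w i = u i) (hw1 : w (2 * N + 1) = none)
    (t : ℝ) :
    HasDerivAt (extPf α ζ b u (N + 1))
      (extPf α ζ b w (N + 1) t - N * α * extPf α ζ b u (N + 1) t) t := by
  set A := extEntry α ζ b t with hA
  have hskew := extEntry_skew hα hζ b t
  set l := 2 * N + 1 with hl
  -- The factor `α` belongs to the entries that do not involve `d₀`.
  have h1 : HasDerivAt (extPf α ζ b u (N + 1)) (pfDeriv (N + 1) (fun i j => A (u i) (u j))
      fun i j => (rowVar A u l none i j +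
        (A (some .d0) (u i) * A none (u j) - A (some .d0) (u j) * A none (u i))) +
        ((-α) * A (u i) (u j) + α * rowVar A u l (some .d0) i j)) t := by
    refine hasDerivAt_pfSeq fun i hi j hj => ?_
    rcases Nat.lt_or_ge i l with hil | hil
    · obtain ⟨a, ha⟩ := hu i (by omega)
      rcases Nat.lt_or_ge j l with hjl | hjl
      · obtain ⟨c, hc⟩ := hu j (by omega)
        simp only [rowVar, if_neg hil.ne, if_neg hjl.ne, ha, hc]
        refine (hasDerivAt_entry hα hζ b t a c).congr_deriv ?_
        rw [entry_succ_add_entry_succ hα hζ]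
        simp only [hA, extEntry, entry]
        ring
      · obtain rfl : j = l := by omega
        simp only [rowVar, if_neg hil.ne, if_true, ha, hd]
        refine (hasDerivAt_moment ζ b a t).neg.congr_deriv ?_
        simp only [hA, extEntry, entry]
        ring
    · obtain rfl : i = l := by omega
      rcases Nat.lt_or_ge j l with hjl | hjl
      · obtain ⟨c, hc⟩ := hu j (by omega)
        simp only [rowVar, if_neg hjl.ne, if_true, hc, hd]
        refine (hasDerivAt_moment ζ b c t).congr_deriv ?_
        simp only [hA, extEntry, entry]
        ring
      · obtain rfl : j = l := by omega
        simp only [rowVar, if_true, hd]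
        refine (hasDerivAt_const t 0).congr_deriv ?_
        simp only [hA, extEntry, entry]
        ring
  refine h1.congr_deriv ?_
  rw [pfDeriv_add, pfDeriv_add, pfDeriv_add, pfDeriv_smul, pfDeriv_smul, pfDeriv_self,
    pfDeriv_rowVar hskew _ _ _ (by omega), pfDeriv_rowVar hskew _ _ _ (by omega),
    pfDeriv_wedge hskew _ u _ _ rfl]
  have h2 : pfSeq (N + 1) (fun i j => A (Function.update u l none i)
      (Function.update u l none j)) = extPf α ζ b w (N + 1) t := by
    refine congrFun (extPf_congr fun i hi => ?_) t
    rcases eq_or_ne i l with rfl | h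
    · rw [Function.update_self, hw1]
    · rw [Function.update_of_ne h, hw i (by omega)]
  have h3 : Function.update u l (some .d0) = u := by rw [← hd, Function.update_eq_self]
  -- The character `d₀` occurs twice in the Pfaffian that arises by adjoining `d₀` and `d₁`.
  have h4 := pfSeq_eq_zero_of_eq hskew (N := N + 1 + 1)
    (appendSeq (2 * (N + 1)) u (seqTwo (some .d0) none))
    (i := l) (j := l + 1) (by omega) (by omega) (by omega) (by
      rw [appendSeq, appendSeq, if_pos (by omega), if_neg (by omega), hd,
        show l + 1 - 2 * (N + 1) = 0 by omega]
      rfl)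
  have h5 : pfSeq (N + 1) (fun i j => A (u i) (u j)) = extPf α ζ b u (N + 1) t := rfl
  rw [h2, h3, h4, h5]
  push_cast
  ring

/-! ### The bilinear equation -/

theorem differentiable_tau (hα : 0 ≤ α) (hζ : ∀ j, 0 < ζ j) (b : Fin n → ℝ) (k : ℕ) :
    Differentiable ℝ (tau α ζ b k) := by
  have h : tau α ζ b k = fun t => (k.factorial : ℝ)⁻¹ *
      ∑ φ : Fin k → Fin n, (∏ i, expWeight ζ b t (φ i)) * interaction α ζ φ := by
    funext t
    rw [← factorial_mul_tau hα hζ, inv_mul_cancel_left₀ (Nat.cast_ne_zero.2 k.factorial_ne_zero)]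
  rw [h]
  unfold expWeight
  fun_prop

/-- The bilinear equation of the lattice for the tau functions with indices `k`, `k + 1` and
`k + 2`. -/
def BilinearAt (α : ℝ) (ζ b : Fin n → ℝ) (k : ℕ) : Prop :=
  ∃ D D₂ : ℝ → ℝ, ∀ t, HasDerivAt (tau α ζ b (k + 1 : ℕ)) (D t) t ∧ HasDerivAt D (D₂ t) t ∧
    D₂ t * tau α ζ b (k + 1 : ℕ) t - D t ^ 2 =
      deriv (tau α ζ b (k + 2 : ℕ)) t * tau α ζ b k t -
        tau α ζ b (k + 2 : ℕ) t * deriv (tau α ζ b k) t +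
          α * tau α ζ b (k + 2 : ℕ) t * tau α ζ b k t

/-- The characters `0, …, 2m-1, x, y`. -/
abbrev withTwo (m : ℕ) (x y : Option Label) : ℕ → Option Label :=
  appendSeq (2 * m) numLabel (seqTwo x y)

/-- The characters `0, …, 2m-1, x, y, z, w`. -/
abbrev withFour (m : ℕ) (x y z w : Option Label) : ℕ → Option Label :=
  appendSeq (2 * m) numLabel (seqFour x y z w)

theorem appendSeq_add {L : Type*} (k i : ℕ) (b w : ℕ → L) : appendSeq k b w (k + i) = w i := by
  simp [appendSeq]

theorem withTwo_lt {m i : ℕ} (h : i < 2 * m) (x y : Option Label) :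
    withTwo m x y i = numLabel i :=
  if_pos h

theorem withFour_lt {m i : ℕ} (h : i < 2 * m) (x y z w : Option Label) :
    withFour m x y z w i = numLabel i :=
  if_pos h

theorem withTwo_zero (m : ℕ) (x y : Option Label) : withTwo m x y (2 * m) = x :=
  appendSeq_add _ 0 _ _

theorem withTwo_one (m : ℕ) (x y : Option Label) : withTwo m x y (2 * m + 1) = y :=
  appendSeq_add _ 1 _ _

theorem withFour_zero (m : ℕ) (x y z w : Option Label) : withFour m x y z w (2 * m) = x :=
  appendSeq_add _ 0 _ _

theorem withFour_one (m : ℕ) (x y z w : Option Label) : withFour m x y z w (2 * m + 1) = y :=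
  appendSeq_add _ 1 _ _

theorem withFour_two (m : ℕ) (x y z w : Option Label) : withFour m x y z w (2 * m + 2) = z :=
  appendSeq_add _ 2 _ _

theorem withFour_three (m : ℕ) (x y z w : Option Label) : withFour m x y z w (2 * m + 3) = w :=
  appendSeq_add _ 3 _ _

theorem withFour_eq_withTwo {m i : ℕ} (hi : i < 2 * (m + 1)) (x y z w : Option Label) :
    withFour m x y z w i = withTwo m x y i := by
  rcases lt_trichotomy i (2 * m) with h | rfl | h
  · rw [withFour_lt h, withTwo_lt h]
  · rw [withTwo_zero, withFour_zero]
  · obtain rfl : i = 2 * m + 1 := by omega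
    rw [withTwo_one, withFour_one]

theorem withTwo_congr {m i : ℕ} (hi : i ≤ 2 * m) (x y y' : Option Label) :
    withTwo m x y i = withTwo m x y' i := by
  rcases lt_or_eq_of_le hi with h | rfl
  · rw [withTwo_lt h, withTwo_lt h]
  · rw [withTwo_zero, withTwo_zero]

theorem withFour_congr {m i : ℕ} (hi : i ≤ 2 * (m + 1)) (x y z w w' : Option Label) :
    withFour m x y z w i = withFour m x y z w' i := by
  rcases Nat.lt_or_ge i (2 * (m + 1)) with h | h
  · rw [withFour_eq_withTwo h, withFour_eq_withTwo h]
  · obtain rfl : i = 2 * m + 2 := by omega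
    rw [withFour_two, withFour_two]

theorem exists_withTwo_eq {m i : ℕ} (hi : i < 2 * (m + 1)) (a c : ℕ) :
    ∃ e, withTwo m (numLabel a) (numLabel c) i = numLabel e := by
  rcases lt_trichotomy i (2 * m) with h | rfl | h
  · exact ⟨i, withTwo_lt h _ _⟩
  · exact ⟨a, withTwo_zero _ _ _⟩
  · obtain rfl : i = 2 * m + 1 := by omega
    exact ⟨c, withTwo_one _ _ _⟩

theorem withTwo_eq_numLabel {m i : ℕ} (hi : i ≤ 2 * m) (y : Option Label) :
    withTwo m (numLabel (2 * m)) y i = numLabel i := by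
  rcases lt_or_eq_of_le hi with h | rfl
  · exact withTwo_lt h _ _
  · exact withTwo_zero _ _ _

theorem withTwo_numLabel_eq_numLabel {m i : ℕ} (hi : i < 2 * (m + 1)) :
    withTwo m (numLabel (2 * m)) (numLabel (2 * m + 1)) i = numLabel i := by
  rcases Nat.lt_or_ge i (2 * m + 1) with h | h
  · exact withTwo_eq_numLabel (Nat.lt_succ_iff.1 h) _
  · obtain rfl : i = 2 * m + 1 := by omega
    exact withTwo_one _ _ _

theorem hasDerivAt_extPf_withTwo_numLabel (hα : 0 ≤ α) (hζ : ∀ j, 0 < ζ j) (b : Fin n → ℝ)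
    (m a c : ℕ) (t : ℝ) :
    HasDerivAt (extPf α ζ b (withTwo m (numLabel a) (numLabel c)) (m + 1))
      (-extPf α ζ b (withFour m (numLabel a) (numLabel c) (some .d0) none) (m + 2) t -
        (m + 1) * α * extPf α ζ b (withTwo m (numLabel a) (numLabel c)) (m + 1) t) t := by
  have := hasDerivAt_extPf_adjoin hα hζ b (N := m + 1)
    (u := withTwo m (numLabel a) (numLabel c))
    (w := withFour m (numLabel a) (numLabel c) (some .d0) none)
    (fun i hi => exists_withTwo_eq hi a c) (fun i hi => withFour_eq_withTwo hi _ _ _ _)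
    (withFour_two _ _ _ _ _) (withFour_three _ _ _ _ _) t
  exact_mod_cast this

theorem hasDerivAt_extPf_withTwo_d0 (hα : 0 ≤ α) (hζ : ∀ j, 0 < ζ j) (b : Fin n → ℝ)
    (m a : ℕ) (t : ℝ) :
    HasDerivAt (extPf α ζ b (withTwo m (numLabel a) (some .d0)) (m + 1))
      (extPf α ζ b (withTwo m (numLabel a) none) (m + 1) t -
        m * α * extPf α ζ b (withTwo m (numLabel a) (some .d0)) (m + 1) t) t :=
  hasDerivAt_extPf_replace hα hζ b
    (fun i hi => by
      rw [withTwo_congr hi _ _ (numLabel 0)]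
      exact exists_withTwo_eq (by omega) a 0)
    (withTwo_one _ _ _) (fun i hi => withTwo_congr hi _ _ _) (withTwo_one _ _ _) t

theorem hasDerivAt_extPf_withFour_d0 (hα : 0 ≤ α) (hζ : ∀ j, 0 < ζ j) (b : Fin n → ℝ)
    (m a c e : ℕ) (t : ℝ) :
    HasDerivAt (extPf α ζ b (withFour m (numLabel a) (numLabel c) (numLabel e) (some .d0)) (m + 2))
      (extPf α ζ b (withFour m (numLabel a) (numLabel c) (numLabel e) none) (m + 2) t -
        (m + 1) * α *
          extPf α ζ b (withFour m (numLabel a) (numLabel c) (numLabel e) (some .d0)) (m + 2) t)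
      t := by
  have := hasDerivAt_extPf_replace hα hζ b (N := m + 1)
    (u := withFour m (numLabel a) (numLabel c) (numLabel e) (some .d0))
    (w := withFour m (numLabel a) (numLabel c) (numLabel e) none)
    (fun i hi => by
      rcases Nat.lt_or_ge i (2 * (m + 1)) with h | h
      · rw [withFour_eq_withTwo h]
        exact exists_withTwo_eq h a c
      · obtain rfl : i = 2 * m + 2 := by omega
        exact ⟨e, withFour_two _ _ _ _ _⟩)
    (withFour_three _ _ _ _ _) (fun i hi => withFour_congr hi _ _ _ _ _)
    (withFour_three _ _ _ _ _) t
  exact_mod_cast this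

theorem extPf_numLabel_ne_zero {b : Fin n → ℝ} (hpos : ∀ k ≤ n, ∀ t, 0 < tau α ζ b k t) (t : ℝ)
    {j : ℕ} (hj : 2 * j ≤ n) :
    pfSeq j (fun i k => extEntry α ζ b t (numLabel i) (numLabel k)) ≠ 0 :=
  (congrFun (extPf_eq_tau_two_mul (u := numLabel) fun _ _ => rfl) t).trans_ne (hpos _ hj t).ne'

/-- For an odd middle index the bilinear equation is the quadratic relation between the Pfaffians
that extend `0, …, 2m-1` by four, two or none of the characters `2m`, `2m+1`, `d₀`, `d₁`. -/
theorem bilinearAt_two_mul (hα : 0 ≤ α) (hζ : ∀ j, 0 < ζ j) {b : Fin n → ℝ}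
    (hpos : ∀ k ≤ n, ∀ t, 0 < tau α ζ b k t) (m : ℕ) (hm : 2 * m ≤ n) :
    BilinearAt α ζ b (2 * m) := by
  have e0 : extPf α ζ b numLabel m = tau α ζ b (2 * m : ℕ) :=
    extPf_eq_tau_two_mul fun _ _ => rfl
  have e2 : extPf α ζ b (withTwo m (numLabel (2 * m)) (numLabel (2 * m + 1))) (m + 1) =
      tau α ζ b (2 * m + 2 : ℕ) :=
    extPf_eq_tau_two_mul (m := m + 1) fun i hi => withTwo_numLabel_eq_numLabel hi
  have e1 : extPf α ζ b (withTwo m (numLabel (2 * m)) (some .d0)) (m + 1) =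
      fun t => -tau α ζ b (2 * m + 1 : ℕ) t :=
    extPf_eq_neg_tau hα hζ (fun i hi => withTwo_eq_numLabel hi _) (withTwo_one _ _ _)
  have d1 := fun t => hasDerivAt_extPf_raise hα hζ b (N := m + 1) (k := 2 * m) (by omega)
    (u := withTwo m (numLabel (2 * m)) (some .d0))
    (w := withTwo m (numLabel (2 * m + 1)) (some .d0)) (fun i hi => withTwo_eq_numLabel hi _)
    (fun i hi hi' => by
      obtain rfl : i = 2 * m + 1 := by omega
      exact withTwo_one _ _ _)
    (withTwo_zero _ _ _) (fun i hi hne => by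
      rcases lt_trichotomy i (2 * m) with h | h | h
      · rw [withTwo_lt h, withTwo_lt h]
      · exact absurd h hne
      · obtain rfl : i = 2 * m + 1 := by omega
        rw [withTwo_one, withTwo_one]) t
  refine ⟨fun t => -extPf α ζ b (withTwo m (numLabel (2 * m + 1)) (some .d0)) (m + 1) t,
    _, fun t => ⟨?_, (hasDerivAt_extPf_withTwo_d0 hα hζ b m (2 * m + 1) t).neg, ?_⟩⟩
  · have h := (d1 t).neg
    rw [e1] at h
    simpa [Pi.neg_def] using h
  · have h0 := (hasDerivAt_extPf_adjoin hα hζ b (N := m) (u := numLabel)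
      (w := withTwo m (some .d0) none) (fun i _ => ⟨i, rfl⟩) (fun i hi => withTwo_lt hi _ _)
      (withTwo_zero _ _ _) (withTwo_one _ _ _) t).deriv
    have h2 := (hasDerivAt_extPf_withTwo_numLabel hα hζ b m (2 * m) (2 * m + 1) t).deriv
    have h1 := (d1 t).unique (hasDerivAt_extPf_withTwo_d0 hα hζ b m (2 * m) t)
    have hpl := pfSeq_mul_pfSeq_four (extEntry_skew hα hζ b t) m numLabel
      (fun j hj => extPf_numLabel_ne_zero hpos t (by omega))
      (P := fun u N => extPf α ζ b u N t) rfl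
      (numLabel (2 * m)) (numLabel (2 * m + 1)) (some .d0) none
    have e1t := congrFun e1 t
    beta_reduce at hpl e1t
    rw [e0] at h0 hpl
    rw [e2] at h2 hpl
    rw [h0, h2]
    rw [e1t] at h1 hpl
    set X := extPf α ζ b (withTwo m (numLabel (2 * m + 1)) (some .d0)) (m + 1) t
    linear_combination hpl + (-X) * h1

/-- For an even middle index the bilinear equation is the quadratic relation between the Pfaffians
that extend `0, …, 2m` by three or one of the characters `2m+1`, `2m+2`, `d₀`, `d₁`. -/
theorem bilinearAt_two_mul_add_one (hα : 0 ≤ α) (hζ : ∀ j, 0 < ζ j) {b : Fin n → ℝ}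
    (hpos : ∀ k ≤ n, ∀ t, 0 < tau α ζ b k t) (m : ℕ) (hm : 2 * m ≤ n) :
    BilinearAt α ζ b (2 * m + 1) := by
  have e2 : extPf α ζ b (withTwo m (numLabel (2 * m)) (numLabel (2 * m + 1))) (m + 1) =
      tau α ζ b (2 * m + 1 + 1 : ℕ) :=
    extPf_eq_tau_two_mul (m := m + 1) fun i hi => withTwo_numLabel_eq_numLabel hi
  have e1 : extPf α ζ b (withTwo m (numLabel (2 * m)) (some .d0)) (m + 1) =
      fun t => -tau α ζ b (2 * m + 1 : ℕ) t :=
    extPf_eq_neg_tau hα hζ (fun i hi => withTwo_eq_numLabel hi _) (withTwo_one _ _ _)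
  have e3 : extPf α ζ b (withFour m (numLabel (2 * m)) (numLabel (2 * m + 1))
      (numLabel (2 * m + 2)) (some .d0)) (m + 2) =
      fun t => -tau α ζ b (2 * m + 1 + 2 : ℕ) t :=
    extPf_eq_neg_tau hα hζ (m := m + 1) (fun i hi => by
      rcases Nat.lt_or_ge i (2 * (m + 1)) with h | h
      · rw [withFour_eq_withTwo h, withTwo_numLabel_eq_numLabel h]
      · obtain rfl : i = 2 * m + 2 := by omega
        exact withFour_two _ _ _ _ _) (withFour_three _ _ _ _ _)
  have d2 := fun t => hasDerivAt_extPf_raise hα hζ b (N := m + 1) (k := 2 * m + 1) (by omega)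
    (u := withTwo m (numLabel (2 * m)) (numLabel (2 * m + 1)))
    (w := withTwo m (numLabel (2 * m)) (numLabel (2 * m + 2)))
    (fun i hi => withTwo_numLabel_eq_numLabel (by omega)) (fun i hi hi' => by omega)
    (withTwo_one _ _ _) (fun i hi hne => withTwo_congr (by omega) _ _ _) t
  refine ⟨extPf α ζ b (withTwo m (numLabel (2 * m)) (numLabel (2 * m + 2))) (m + 1),
    _, fun t => ⟨?_, hasDerivAt_extPf_withTwo_numLabel hα hζ b m (2 * m) (2 * m + 2) t, ?_⟩⟩
  · have h := d2 t
    rwa [e2] at h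
  · have h2 := (d2 t).unique (hasDerivAt_extPf_withTwo_numLabel hα hζ b m (2 * m) (2 * m + 1) t)
    have h1 := hasDerivAt_extPf_withTwo_d0 hα hζ b m (2 * m) t
    have h3 := hasDerivAt_extPf_withFour_d0 hα hζ b m (2 * m) (2 * m + 1) (2 * m + 2) t
    have hpl := pfSeq_two_mul_pfSeq_four (extEntry_skew hα hζ b t) m numLabel
      (fun j hj => extPf_numLabel_ne_zero hpos t (by omega))
      (P := fun u N => extPf α ζ b u N t) rfl
      (numLabel (2 * m)) (numLabel (2 * m + 1)) (numLabel (2 * m + 2)) (some .d0) none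
    have e1t := congrFun e1 t
    have e3t := congrFun e3 t
    have h1' := h1.neg.deriv
    have h3' := h3.neg.deriv
    beta_reduce at hpl e1t e3t
    have hn : ∀ f : ℝ → ℝ, (-fun t => -f t) = f := fun f => by funext s; simp
    rw [e1, hn] at h1'
    rw [e3, hn] at h3'
    rw [e2] at h2 hpl
    rw [e1t] at hpl
    rw [e3t] at hpl
    rw [h1', h3']
    set X := extPf α ζ b (withTwo m (numLabel (2 * m)) (numLabel (2 * m + 2))) (m + 1) t
    linear_combination (-1 : ℝ) * hpl + (-X) * h2

theorem bilinearAt (hα : 0 ≤ α) (hζ : ∀ j, 0 < ζ j) {b : Fin n → ℝ}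
    (hpos : ∀ k ≤ n, ∀ t, 0 < tau α ζ b k t) {k : ℕ} (hk : k ≤ n) : BilinearAt α ζ b k := by
  rcases Nat.even_or_odd' k with ⟨m, rfl | rfl⟩
  · exact bilinearAt_two_mul hα hζ hpos m hk
  · exact bilinearAt_two_mul_add_one hα hζ hpos m (by omega)

end

end BToda


end

theorem mainTheorem9 (n : ℕ) (α : ℝ) (hα : 0 ≤ α) (ζ b : Fin n → ℝ)
    (hζpos : ∀ j, 0 < ζ j) (hζ : StrictMono ζ) (hb : ∀ j, 0 < b j) :
    (∀ (i j : ℕ) (t : ℝ),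
      IntegrableOn (BToda.entryIntegrand α ζ b i j) (BToda.wedge t)) ∧
    (∀ k : ℤ, 0 ≤ k → k ≤ n →
      (∀ t, 0 < BToda.tau α ζ b k t) ∧ Differentiable ℝ (BToda.tau α ζ b k)) ∧
    (∀ t, BToda.tau α ζ b (n + 1) t = 0) ∧
    ∀ p q : ℤ → ℝ → ℝ,
      (∀ k : ℤ, 0 ≤ k → k ≤ n → ∀ t,
        p k t = BToda.tau α ζ b (k + 1) t * BToda.tau α ζ b (k - 1) t /
          BToda.tau α ζ b k t ^ 2) →
      (∀ k : ℤ, 0 ≤ k → k ≤ n → ∀ t,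
        q k t = deriv (fun s => Real.log (BToda.tau α ζ b k s)) t) →
      BToda.IsLatticeSolution n α p q := by
  have hpos : ∀ k : ℕ, k ≤ n → ∀ t, 0 < BToda.tau α ζ b k t :=
    fun k hk t => BToda.tau_pos hα hζpos hζ hb hk t
  have hdiff := BToda.differentiable_tau hα hζpos b
  have hlast : ∀ t, BToda.tau α ζ b (n + 1) t = 0 := fun t => by
    exact_mod_cast BToda.tau_eq_zero hα hζpos b (Nat.lt_succ_self n) t
  refine ⟨BToda.integrableOn_entryIntegrand hα hζpos b, fun k hk0 hkn => ?_, hlast,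
    fun p q hp hq => ?_⟩
  · lift k to ℕ using hk0
    exact ⟨hpos k (by exact_mod_cast hkn), hdiff k⟩
  have hzero : ∀ t, BToda.tau α ζ b 0 t = 1 := fun t => by
    have := BToda.tau_two_mul α ζ b 0 t
    rw [BToda.pfSeq_zero] at this
    exact_mod_cast this
  have hneg : ∀ t, BToda.tau α ζ b (0 - 1) t = 0 := fun t => by simp [BToda.tau]
  have hp0 : ∀ t, p 0 t = 0 := fun t => by
    rw [hp 0 le_rfl (by positivity), hneg]
    simp
  have hpn : ∀ t, p n t = 0 := fun t => by
    rw [hp n (by positivity) le_rfl, hlast]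
    simp
  have hq' : ∀ k : ℕ, k ≤ n → ∀ t,
      q k t = deriv (BToda.tau α ζ b k) t / BToda.tau α ζ b k t := fun k hk t => by
    rw [hq k (by positivity) (by exact_mod_cast hk)]
    exact ((hdiff k t).hasDerivAt.log (hpos k hk t).ne').deriv
  refine ⟨hp0, hpn, fun t => ?_, fun t => ?_, fun k hk1 hkn t => ?_, fun k hk1 hkn t => ?_⟩
  · rw [hq 0 le_rfl (by positivity)]
    simp [hzero]
  · rw [hpn, zero_mul]
  · obtain ⟨k, rfl⟩ : ∃ k' : ℕ, k = (k' + 1 : ℕ) :=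
      ⟨(k - 1).toNat, by omega⟩
    have hkn' : k + 1 ≤ n := by exact_mod_cast hkn
    have s1 : ((k + 1 : ℕ) : ℤ) + 1 = (k + 2 : ℕ) := by push_cast; ring
    have s2 : ((k + 1 : ℕ) : ℤ) - 1 = (k : ℕ) := by push_cast; ring
    rcases eq_or_lt_of_le hkn' with rfl | hlt
    · -- At the end of the lattice `p` vanishes identically.
      have : p (k + 1 : ℕ) = fun _ => 0 := funext hpn
      rw [this]
      simpa using hasDerivAt_const t (0 : ℝ)
    · have hpk : p (k + 1 : ℕ) = fun s => BToda.tau α ζ b (k + 2 : ℕ) s * BToda.tau α ζ b k s /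
          BToda.tau α ζ b (k + 1 : ℕ) s ^ 2 := funext fun s => by
        rw [hp _ (by positivity) (by exact_mod_cast hkn'), s1, s2]
      have h0 := (hpos k (by omega) t).ne'
      have h1 := (hpos (k + 1) hkn' t).ne'
      have h2 := (hpos (k + 2) hlt t).ne'
      rw [s1, s2, hq' k (by omega), hq' (k + 1) hkn', hq' (k + 2) hlt, hpk]
      refine (((hdiff (k + 2) t).hasDerivAt.mul (hdiff k t).hasDerivAt).div
        ((hdiff (k + 1) t).hasDerivAt.pow 2) (pow_ne_zero 2 h1)).congr_deriv ?_
      simp only [Pi.mul_apply, Pi.pow_apply]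
      field_simp
      ring
  · obtain ⟨k, rfl⟩ : ∃ k' : ℕ, k = (k' + 1 : ℕ) :=
      ⟨(k - 1).toNat, by omega⟩
    have hkn' : k + 1 ≤ n := by exact_mod_cast hkn
    have s1 : ((k + 1 : ℕ) : ℤ) + 1 = (k + 2 : ℕ) := by push_cast; ring
    have s2 : ((k + 1 : ℕ) : ℤ) - 1 = (k : ℕ) := by push_cast; ring
    obtain ⟨D, D₂, hD⟩ := BToda.bilinearAt hα hζpos hpos (k := k) (by omega)
    have hqk : q (k + 1 : ℕ) = fun s => D s / BToda.tau α ζ b (k + 1 : ℕ) s := funext fun s => by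
      rw [hq' (k + 1) hkn', (hD s).1.deriv]
    have h0 := (hpos k (by omega) t).ne'
    have h1 := (hpos (k + 1) hkn' t).ne'
    obtain ⟨ha, hb', hc⟩ := hD t
    rw [hqk]
    refine (hb'.div ha h1).congr_deriv ?_
    rw [s1, s2, hp _ (by positivity) (by exact_mod_cast hkn'), s1, s2, hq' k (by omega)]
    -- The product `q_{k+2} τ_{k+2}` is the derivative of `τ_{k+2}`, also at the end of the
    -- lattice, where both sides vanish.
    have hqτ : q (k + 2 : ℕ) t * BToda.tau α ζ b (k + 2 : ℕ) t =
        deriv (BToda.tau α ζ b (k + 2 : ℕ)) t := by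
      rcases Nat.lt_or_ge n (k + 2) with hlt | hle
      · have : BToda.tau α ζ b (k + 2 : ℕ) = fun _ => 0 :=
          funext fun s => BToda.tau_eq_zero hα hζpos b hlt s
        rw [this]
        simp
      · rw [hq' (k + 2) hle, div_mul_cancel₀ _ (hpos (k + 2) hle t).ne']
    field_simp
    linear_combination hc - BToda.tau α ζ b k t * hqτ
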